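/- **Setting.** Consider a linear system $\dot x=Ax+Bu+B_ww$, $y_1=C_1x+D_{1w}w$, $y_2=C_2x+D_{2w}w$ with real matrices and $A$ Hurwitz, and put $\Pi_{iu}:=C_i(-A)^{-1}B$, $i=1,2$. Let $0<m\le L_f$, $L_h\ge 0$, $\mu>0$, $\hat L_f:=L_f-m$, and let $Q\succeq 0$ (symmetric). For $\gamma>0$ and $\epsilon>0$ put $$\mathbf A^\gamma_\epsilon:=\begin{bmatrix}\frac1\epsilon A&\frac1\epsilon B&0\\0&-mI&0\\0&0&-\mu I-\gamma Q\end{bmatrix},\quad \mathbf B:=\begin{bmatrix}0&0&0\\-I&-\Pi_{1u}^\top&-\frac1\mu\Pi_{2u}^\top\\0&0&I\end{bmatrix},\quad \mathbf C:=\begin{bmatrix}0&I&0\\C_1&0&0\\C_2&0&\mu I\end{bmatrix},$$ $\mathbf A^\gamma_{\epsilon\rho}:=\mathbf A^\gamma_\epsilon+\rho I$, and $$\Xi_\varphi:=\begin{bmatrix}0&M\\M&-2N\end{bmatrix},\quad M=\mathrm{diag}(\varphi_1\hat L_fI,\varphi_2L_hI,I),\quad N=\mathrm{diag}(\varphi_1I,\varphi_2I,I).$$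 **Theorem.** Assume $\mathrm{null}(\Pi_{2u}\Pi_{2u}^\top)\cap\mathrm{null}(Q)=\{0\}$ and $\mu\ge\max\{\hat L_f,L_h\}$. Then for every $\gamma>0$ there exist $\epsilon>0$, $\rho>0$, $\varphi_1,\varphi_2\ge0$ and $\mathbf P\succ0$ such that $$\begin{bmatrix}(\mathbf A^\gamma_{\epsilon\rho})^\top\mathbf P+\mathbf P\mathbf A^\gamma_{\epsilon\rho}&\mathbf P\mathbf B\\\mathbf B^\top\mathbf P&0\end{bmatrix}+\begin{bmatrix}\mathbf C^\top&0\\0&I\end{bmatrix}\Xi_\varphi\begin{bmatrix}\mathbf C&0\\0&I\end{bmatrix}\preceq0 .$$ Moreover, with these same $\epsilon,\rho,\mathbf P$ the regularized scheme tracks its approximate optimal trajectory, as follows. Let $w$ be any disturbance and, for all $t\ge0$, let $f^t$ be $m$-strongly convex with $L_f$-Lipschitz gradient, $h^t$ convex with $L_h$-Lipschitz gradient, and $g^t$ (with values in $(-\infty,\infty]$) proper, convex and lower semicontinuous, with Moreau envelope $M_{\mu g^t}(v)=\min_x\big(g^t(x)+\frac1{2\mu}\|x-v\|^2\big)$. Let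 $\mathbf z=(x,u,\lambda)$ be a Carathéodory solution on $[0,\infty)$ of $$\epsilon\dot x=Ax+Bu+B_ww,\quad \dot u=-\nabla f^t(u)-\Pi_{1u}^\top\nabla h^t(y_1)-\Pi_{2u}^\top\nabla M_{\mu g^t}(y_2+\mu\lambda),\quad \dot\lambda=\mu\big(\nabla M_{\mu g^t}(y_2+\mu\lambda)-\lambda\big)-\gamma Q\lambda,$$ with $y_i=C_ix+D_{iw}w$, and let $\mathbf z^{\star\gamma}$ be an approximate optimal trajectory, i.e. for every $t\ge0$ the right-hand sides vanish at $\mathbf z^{\star\gamma}(t)$, with $\mathbf z^{\star\gamma}(t)=\mathbf z^{\star\gamma}(0)+\int_0^t\dot{\mathbf z}^{\star\gamma}(\tau)\,\mathrm d\tau$ for a locally integrable $\dot{\mathbf z}^{\star\gamma}$. Then, for all $t\ge0$, with $\kappa(\mathbf P)$ the condition number of $\mathbf P$, $$\|\mathbf z(t)-\mathbf z^{\star\gamma}(t)\|\le\sqrt{\kappa(\mathbf P)}\,\|\mathbf z(0)-\mathbf z^{\star\gamma}(0)\|\,e^{-\rho t}+\sqrt{\kappa(\mathbf P)}\int_0^te^{-\rho(t-\tau)}\|\dot{\mathbf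 z}^{\star\gamma}(\tau)\|\,\mathrm d\tau .$$ -/

import Mathlib

open Matrix MeasureTheory Set

namespace OnlineOpt

noncomputable section

/-! ### Matrices -/

/-- A real square matrix is Hurwitz (stable) if all its complex eigenvalues have negative real
part. -/
def IsHurwitz {n : Type*} [Fintype n] [DecidableEq n] (A : Matrix n n ℝ) : Prop :=
  ∀ s ∈ spectrum ℂ (A.map (fun r : ℝ => (r : ℂ))), s.re < 0

/-- The `3 × 3` block matrix with the given blocks. -/
def blocks3 {r₁ r₂ r₃ c₁ c₂ c₃ : Type*}
    (M₁₁ : Matrix r₁ c₁ ℝ) (M₁₂ : Matrix r₁ c₂ ℝ) (M₁₃ : Matrix r₁ c₃ ℝ)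
    (M₂₁ : Matrix r₂ c₁ ℝ) (M₂₂ : Matrix r₂ c₂ ℝ) (M₂₃ : Matrix r₂ c₃ ℝ)
    (M₃₁ : Matrix r₃ c₁ ℝ) (M₃₂ : Matrix r₃ c₂ ℝ) (M₃₃ : Matrix r₃ c₃ ℝ) :
    Matrix (r₁ ⊕ (r₂ ⊕ r₃)) (c₁ ⊕ (c₂ ⊕ c₃)) ℝ :=
  fromBlocks M₁₁ (fromCols M₁₂ M₁₃) (fromRows M₂₁ M₃₁) (fromBlocks M₂₂ M₂₃ M₃₂ M₃₃)

/-- The condition number `‖P‖ ‖P⁻¹‖` for the spectral norm; for a positive definite `P` it is the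
ratio of the largest to the smallest eigenvalue. -/
def condNumber {n : Type*} [Fintype n] [DecidableEq n] (P : Matrix n n ℝ) : ℝ :=
  ‖toEuclideanCLM (n := n) (𝕜 := ℝ) P‖ * ‖toEuclideanCLM (n := n) (𝕜 := ℝ) P⁻¹‖

/-- The LMI `[AᵀP + PA, PB; BᵀP, 0] + [Cᵀ, 0; 0, I] Ξ [C, 0; 0, I] ⪯ 0`, where `v` indexes both the
inputs and the outputs of the feedback nonlinearity. -/
def SatisfiesLMI {z v : Type*} [Fintype z] [Fintype v] [DecidableEq v]
    (A : Matrix z z ℝ) (B : Matrix z v ℝ) (C : Matrix v z ℝ)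
    (P : Matrix z z ℝ) (Ξ : Matrix (v ⊕ v) (v ⊕ v) ℝ) : Prop :=
  (-(fromBlocks (Aᵀ * P + P * A) (P * B) (Bᵀ * P) 0 +
      fromBlocks Cᵀ 0 0 (1 : Matrix v v ℝ) * Ξ *
        fromBlocks C 0 0 (1 : Matrix v v ℝ))).PosSemidef

/-- The multiplier `Ξ_φ`, with `Lhat` in the role of `L_f - m`. -/
def multiplier (U Y₁ Y₂ : Type*) [DecidableEq U] [DecidableEq Y₁] [DecidableEq Y₂]
    (Lhat Lh φ₁ φ₂ : ℝ) :
    Matrix ((U ⊕ (Y₁ ⊕ Y₂)) ⊕ (U ⊕ (Y₁ ⊕ Y₂))) ((U ⊕ (Y₁ ⊕ Y₂)) ⊕ (U ⊕ (Y₁ ⊕ Y₂))) ℝ :=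
  fromBlocks
    0
    (blocks3 ((φ₁ * Lhat) • (1 : Matrix U U ℝ)) 0 0
      0 ((φ₂ * Lh) • (1 : Matrix Y₁ Y₁ ℝ)) 0
      0 0 (1 : Matrix Y₂ Y₂ ℝ))
    (blocks3 ((φ₁ * Lhat) • (1 : Matrix U U ℝ)) 0 0
      0 ((φ₂ * Lh) • (1 : Matrix Y₁ Y₁ ℝ)) 0
      0 0 (1 : Matrix Y₂ Y₂ ℝ))
    (blocks3 ((-2 * φ₁) • (1 : Matrix U U ℝ)) 0 0
      0 ((-2 * φ₂) • (1 : Matrix Y₁ Y₁ ℝ)) 0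
      0 0 ((-2 : ℝ) • (1 : Matrix Y₂ Y₂ ℝ)))

/-! ### The plant and the closed-loop matrices -/

/-- The data of `ẋ = A x + B u + B_w w`, `y₁ = C₁ x + D₁w w`, `y₂ = C₂ x + D₂w w`. -/
structure Plant (X U Y₁ Y₂ W : Type*) where
  A : Matrix X X ℝ
  B : Matrix X U ℝ
  Bw : Matrix X W ℝ
  C₁ : Matrix Y₁ X ℝ
  C₂ : Matrix Y₂ X ℝ
  D₁w : Matrix Y₁ W ℝ
  D₂w : Matrix Y₂ W ℝ

namespace Plant

variable {X U Y₁ Y₂ W : Type*} [Fintype X] [DecidableEq X] (S : Plant X U Y₁ Y₂ W)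

/-- `Π₁ᵤ = G₁ᵤ(0)` with `G₁ᵤ(s) = C₁ (s I - A)⁻¹ B`. -/
def Pi₁u : Matrix Y₁ U ℝ := S.C₁ * (-S.A)⁻¹ * S.B

/-- `Π₂ᵤ = G₂ᵤ(0)` with `G₂ᵤ(s) = C₂ (s I - A)⁻¹ B`. -/
def Pi₂u : Matrix Y₂ U ℝ := S.C₂ * (-S.A)⁻¹ * S.B

/-- The matrix `𝐀^γ_ε` of the regularized closed loop with the plant sped up by `1/ε`. -/
def matA [DecidableEq U] [DecidableEq Y₂] (Q : Matrix Y₂ Y₂ ℝ) (m μ γ ε : ℝ) :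
    Matrix (X ⊕ (U ⊕ Y₂)) (X ⊕ (U ⊕ Y₂)) ℝ :=
  blocks3 (ε⁻¹ • S.A) (ε⁻¹ • S.B) 0
    0 ((-m) • (1 : Matrix U U ℝ)) 0
    0 0 ((-μ) • (1 : Matrix Y₂ Y₂ ℝ) - γ • Q)

/-- The input matrix `𝐁`. -/
def matB [DecidableEq U] [DecidableEq Y₂] (μ : ℝ) :
    Matrix (X ⊕ (U ⊕ Y₂)) (U ⊕ (Y₁ ⊕ Y₂)) ℝ :=
  blocks3 0 0 0
    (-(1 : Matrix U U ℝ)) (-S.Pi₁uᵀ) (-(μ⁻¹ • S.Pi₂uᵀ))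
    0 0 (1 : Matrix Y₂ Y₂ ℝ)

/-- The output matrix `𝐂`. -/
def matC [DecidableEq U] [DecidableEq Y₂] (μ : ℝ) :
    Matrix (U ⊕ (Y₁ ⊕ Y₂)) (X ⊕ (U ⊕ Y₂)) ℝ :=
  blocks3 0 (1 : Matrix U U ℝ) 0
    S.C₁ 0 0
    S.C₂ 0 (μ • (1 : Matrix Y₂ Y₂ ℝ))

end Plant

/-! ### Cost functions, proximal operator and Moreau envelope -/

section Convex

variable {E : Type*} [NormedAddCommGroup E]

/-- Proper, convex, lower semicontinuous functions with values in `(-∞, ∞]`; convexity is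
convexity of the epigraph. -/
structure IsProperConvexLSC [NormedSpace ℝ E] (g : E → EReal) : Prop where
  ne_bot : ∀ x, g x ≠ ⊥
  exists_ne_top : ∃ x, g x ≠ ⊤
  convex_epigraph : Convex ℝ {p : E × ℝ | g p.1 ≤ (p.2 : EReal)}
  lsc : LowerSemicontinuous g

/-- `x` minimizes `g(·) + ‖· - v‖² / (2μ)`. -/
def IsProx (μ : ℝ) (g : E → EReal) (v x : E) : Prop :=
  ∀ x' : E, g x + ((1 / (2 * μ) * ‖x - v‖ ^ 2 : ℝ) : EReal) ≤
    g x' + ((1 / (2 * μ) * ‖x' - v‖ ^ 2 : ℝ) : EReal)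

/-- The proximal operator `prox_{μg}`. (For `μ > 0` and `g` proper, convex and lower semicontinuous
on a Euclidean space the minimizer exists and is unique.) -/
def prox (μ : ℝ) (g : E → EReal) (v : E) : E := Classical.epsilon (IsProx μ g v)

/-- The Moreau envelope `M_{μg}`. -/
def moreau (μ : ℝ) (g : E → EReal) (v : E) : ℝ :=
  (g (prox μ g v)).toReal + 1 / (2 * μ) * ‖prox μ g v - v‖ ^ 2

/-- `f` is differentiable with `L`-Lipschitz continuous gradient. -/
def HasLipschitzGradient [InnerProductSpace ℝ E] [CompleteSpace E] (L : ℝ) (f : E → ℝ) : Prop :=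
  Differentiable ℝ f ∧ ∀ x y, ‖gradient f x - gradient f y‖ ≤ L * ‖x - y‖

end Convex

/-- Standing assumption on the time-varying costs: for all `t ≥ 0`, `f^t` is `m`-strongly convex
with `L_f`-Lipschitz gradient, `h^t` is convex with `L_h`-Lipschitz gradient and `g^t` is proper,
convex and lower semicontinuous. -/
structure CostAssumption {U Y₁ Y₂ : Type*} [Fintype U] [Fintype Y₁] [Fintype Y₂]
    (m Lf Lh : ℝ) (f : ℝ → EuclideanSpace ℝ U → ℝ) (h : ℝ → EuclideanSpace ℝ Y₁ → ℝ)
    (g : ℝ → EuclideanSpace ℝ Y₂ → EReal) : Prop where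
  f_strong : ∀ t, 0 ≤ t → StrongConvexOn univ m (f t)
  f_grad : ∀ t, 0 ≤ t → HasLipschitzGradient Lf (f t)
  h_convex : ∀ t, 0 ≤ t → ConvexOn ℝ univ (h t)
  h_grad : ∀ t, 0 ≤ t → HasLipschitzGradient Lh (h t)
  g_proper : ∀ t, 0 ≤ t → IsProperConvexLSC (g t)

/-! ### The regularized algorithm, its trajectories and its stationary points -/

section Dynamics

variable {X U Y₂ : Type*}

/-- The state component of `z = (x, u, l)`. -/
def xPart (z : EuclideanSpace ℝ (X ⊕ (U ⊕ Y₂))) : EuclideanSpace ℝ X :=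
  WithLp.toLp 2 (fun i => z (Sum.inl i))

/-- The input component of `z = (x, u, l)`. -/
def uPart (z : EuclideanSpace ℝ (X ⊕ (U ⊕ Y₂))) : EuclideanSpace ℝ U :=
  WithLp.toLp 2 (fun i => z (Sum.inr (Sum.inl i)))

/-- The multiplier component of `z = (x, u, l)`. -/
def lPart (z : EuclideanSpace ℝ (X ⊕ (U ⊕ Y₂))) : EuclideanSpace ℝ Y₂ :=
  WithLp.toLp 2 (fun i => z (Sum.inr (Sum.inr i)))

/-- The stacked vector `(x, u, l)`. -/
def stack (x : EuclideanSpace ℝ X) (u : EuclideanSpace ℝ U) (l : EuclideanSpace ℝ Y₂) :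
    EuclideanSpace ℝ (X ⊕ (U ⊕ Y₂)) :=
  WithLp.toLp 2 (Sum.elim x (Sum.elim u l))

/-- The right-hand side of the regularized algorithm in closed loop with the plant sped up
by `1/ε`:
`ẋ = (A x + B u + B_w w) / ε`,
`u̇ = -∇f^t(u) - Π₁ᵤᵀ ∇h^t(y₁) - Π₂ᵤᵀ ∇M_{μg^t}(y₂ + μ l)`,
`l̇ = μ (∇M_{μg^t}(y₂ + μ l) - l) - γ Q l`,
with `y₁ = C₁ x + D₁w w` and `y₂ = C₂ x + D₂w w`. -/
def closedLoopField {Y₁ W : Type*} [Fintype X] [DecidableEq X] [Fintype U] [DecidableEq U]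
    [Fintype Y₁] [DecidableEq Y₁] [Fintype Y₂] [DecidableEq Y₂] [Fintype W] [DecidableEq W]
    (S : Plant X U Y₁ Y₂ W) (Q : Matrix Y₂ Y₂ ℝ) (μ γ ε : ℝ)
    (f : ℝ → EuclideanSpace ℝ U → ℝ) (h : ℝ → EuclideanSpace ℝ Y₁ → ℝ)
    (g : ℝ → EuclideanSpace ℝ Y₂ → EReal) (w : ℝ → EuclideanSpace ℝ W)
    (t : ℝ) (z : EuclideanSpace ℝ (X ⊕ (U ⊕ Y₂))) : EuclideanSpace ℝ (X ⊕ (U ⊕ Y₂)) :=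
  let x := xPart z
  let u := uPart z
  let l := lPart z
  let y₁ := toEuclideanLin S.C₁ x + toEuclideanLin S.D₁w (w t)
  let y₂ := toEuclideanLin S.C₂ x + toEuclideanLin S.D₂w (w t)
  let gradM := gradient (moreau μ (g t)) (y₂ + μ • l)
  stack
    (ε⁻¹ • (toEuclideanLin S.A x + toEuclideanLin S.B u + toEuclideanLin S.Bw (w t)))
    (-gradient (f t) u - toEuclideanLin S.Pi₁uᵀ (gradient (h t) y₁)
      - toEuclideanLin S.Pi₂uᵀ gradM)
    (μ • (gradM - l) - γ • toEuclideanLin Q l)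

/-- `z` is, on `[0, ∞)`, the integral of the locally integrable function `v` (so `z` is locally
absolutely continuous there, with derivative `v`). -/
def IsIntegralOf {E : Type*} [NormedAddCommGroup E] [NormedSpace ℝ E] (z v : ℝ → E) : Prop :=
  ∀ t, 0 ≤ t → IntervalIntegrable v volume 0 t ∧ z t = z 0 + ∫ τ in (0 : ℝ)..t, v τ

/-- Caratheodory solutions on `[0, ∞)` of `ż = F(t, z)`. -/
def IsCaratheodorySolution {E : Type*} [NormedAddCommGroup E] [NormedSpace ℝ E]
    (F : ℝ → E → E) (z : ℝ → E) : Prop :=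
  IsIntegralOf z (fun τ => F τ (z τ))

/-- Time-varying stationary points on `[0, ∞)` of `ż = F(t, z)`. -/
def IsStationaryTrajectory {E : Type*} [Zero E] (F : ℝ → E → E) (z : ℝ → E) : Prop :=
  ∀ t, 0 ≤ t → F t (z t) = 0

end Dynamics

end

end OnlineOpt

/-!
The proof has two halves: feasibility of the LMI, and tracking for any solution of the LMI.

*Feasibility.* By `satisfiesLMI_iff` the LMI is a dissipation inequality for the storage function
`z ↦ ⟨z, P z⟩`. Write `H = (-A)⁻¹ B` and let `ξ = x - H u` be the deviation of the plant state from
its equilibrium under the input `u`. The storage function is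
`⟨ξ, R ξ⟩ + μ ‖u‖² + μ ‖l‖² + 2 δ ⟨l, Π₂ᵤ u⟩`, where `R` solves a Lyapunov inequality for `A`
(`IsHurwitz.exists_posDef_lyapunov`). Let `(p, q, r)` be the outputs of the nonlinearity.
For `ξ = 0` and `δ = 0` the weights `φ₁`, `φ₂` can be chosen such that the indefinite terms cancel
or are dominated, and the last channel completes the square `-‖r - μ l‖²`; the result is
nonpositive, and it vanishes only where `u`, `p`, `q` vanish, `r = μ l` and `Q l = 0` (`exists_weights_reducedForm`). There the derivative of the cross term is
`-‖Π₂ᵤᵀ l‖²`, which is negative for `l ≠ 0` by the null space condition. So a small `δ` makes the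
reduced form negative definite, a small `ε` makes the fast part `ε⁻¹ ⟨R ξ, A ξ⟩` absorb all terms
that contain `ξ`, and a small rate `ρ` remains available (`exists_dissipation`). Each of these three
steps is one application of the compactness argument `eventually_forall_add_mul_neg`.

*Tracking.* The nonlinearities satisfy the incremental sector bounds encoded in the multiplier: the
gradients of the smooth convex costs are cocoercive (`norm_sub_sq_le_mul_inner`), and `μ ∇M` is
`v ↦ v - prox v`, which is firmly nonexpansive (`IsProperConvexLSC.hasGradientAt_moreau`,
`IsProperConvexLSC.norm_sub_prox_sq_le`). With the LMI this gives an incremental dissipation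
inequality for the closed loop. Factor `P = Bᵀ B`: then `‖B (z - z⋆)‖` is absolutely continuous
and satisfies `n' ≤ -ρ n + ‖B‖ ‖ż⋆‖` almost everywhere (`norm_le_of_inner_deriv_le`), and
`‖B‖ ‖B⁻¹‖ = √κ(P)`.
-/

namespace OnlineOpt

open Filter Topology
open scoped RealInnerProductSpace

/-! ### A comparison lemma for absolutely continuous curves -/

theorem _root_.AbsolutelyContinuousOnInterval.of_dist_le {α β : Type*} [PseudoMetricSpace α]
    [PseudoMetricSpace β] {f : ℝ → α} {g : ℝ → β} {a b : ℝ}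
    (hg : AbsolutelyContinuousOnInterval g a b)
    (h : ∀ s ∈ uIcc a b, ∀ t ∈ uIcc a b, dist (f s) (f t) ≤ dist (g s) (g t)) :
    AbsolutelyContinuousOnInterval f a b := by
  rw [absolutelyContinuousOnInterval_iff] at hg ⊢
  intro ε hε
  obtain ⟨δ, hδ, H⟩ := hg ε hε
  refine ⟨δ, hδ, fun I hI hl => lt_of_le_of_lt (Finset.sum_le_sum fun i hi => ?_) (H I hI hl)⟩
  exact h _ (hI.1 i hi).1 _ (hI.1 i hi).2

/-- The norm of a primitive is absolutely continuous, being dominated by the primitive of the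
norm. -/
theorem absolutelyContinuousOnInterval_norm {E : Type*} [NormedAddCommGroup E] [NormedSpace ℝ E]
    {y a : ℝ → E} {T : ℝ} (hT : 0 ≤ T) (ha : IntervalIntegrable a volume 0 T)
    (hy : ∀ t ∈ Icc 0 T, y t = y 0 + ∫ τ in (0 : ℝ)..t, a τ) :
    AbsolutelyContinuousOnInterval (fun t => ‖y t‖) 0 T := by
  refine (ha.norm.absolutelyContinuousOnInterval_intervalIntegral
    (c := 0) left_mem_uIcc).of_dist_le fun s hs t ht => ?_
  have hsub : ∀ r ∈ uIcc 0 T, IntervalIntegrable a volume 0 r := fun r hr =>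
    ha.mono_set (uIcc_subset_uIcc left_mem_uIcc hr)
  rw [Real.dist_eq, Real.dist_eq,
    intervalIntegral.integral_interval_sub_left (hsub s hs).norm (hsub t ht).norm]
  refine (abs_norm_sub_norm_le _ _).trans ?_
  rw [uIcc_of_le hT] at hs ht
  rw [hy s hs, hy t ht, add_sub_add_left_eq_sub,
    intervalIntegral.integral_interval_sub_left (hsub s (by rwa [uIcc_of_le hT]))
      (hsub t (by rwa [uIcc_of_le hT]))]
  exact intervalIntegral.norm_integral_le_abs_integral_norm

/-- Grönwall-type comparison for the norm of an absolutely continuous curve `y` with derivative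
`a`: the inequality `⟪y, a⟫ ≤ -ρ ‖y‖² + ‖y‖ b` forces `‖y‖' ≤ -ρ ‖y‖ + b` almost everywhere. -/
theorem norm_le_of_inner_deriv_le {E : Type*} [NormedAddCommGroup E] [InnerProductSpace ℝ E]
    [CompleteSpace E] {y a : ℝ → E} {b : ℝ → ℝ} {ρ T : ℝ} (hT : 0 ≤ T)
    (ha : IntervalIntegrable a volume 0 T)
    (hy : ∀ t ∈ Icc 0 T, y t = y 0 + ∫ τ in (0 : ℝ)..t, a τ)
    (hb : IntervalIntegrable b volume 0 T) (hb0 : ∀ t ∈ Icc 0 T, 0 ≤ b t)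
    (h : ∀ t ∈ Icc 0 T, ⟪y t, a t⟫ ≤ -ρ * ‖y t‖ ^ 2 + ‖y t‖ * b t) :
    ‖y T‖ ≤ ‖y 0‖ * Real.exp (-ρ * T) + ∫ τ in (0 : ℝ)..T, Real.exp (-ρ * (T - τ)) * b τ := by
  have hn := absolutelyContinuousOnInterval_norm hT ha hy
  have he : AbsolutelyContinuousOnInterval (fun t => Real.exp (ρ * t)) 0 T :=
    ContDiffOn.absolutelyContinuousOnInterval (by fun_prop)
  have hm := he.fun_mul hn
  have hI := hm.integral_deriv_eq_sub
  have hexp : ∀ τ, HasDerivAt (fun t => Real.exp (ρ * t)) (Real.exp (ρ * τ) * ρ) τ := fun τ => by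
    simpa using ((hasDerivAt_id τ).const_mul ρ).exp
  -- integrate the derivative of `exp (ρ t) ‖y t‖`, which is at most `exp (ρ t) b t`
  have hle : ∫ τ in (0 : ℝ)..T, deriv (fun t => Real.exp (ρ * t) * ‖y t‖) τ
      ≤ ∫ τ in (0 : ℝ)..T, Real.exp (ρ * τ) * b τ := by
    refine intervalIntegral.integral_mono_ae_restrict hT hm.intervalIntegrable_deriv
      (hb.continuousOn_mul (by fun_prop)) ?_
    have h0T : ∀ᵐ x ∂(volume : Measure ℝ), x ≠ 0 ∧ x ≠ T := by
      filter_upwards [Measure.ae_ne volume (0 : ℝ), Measure.ae_ne volume T] with x h1 h2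
      exact ⟨h1, h2⟩
    filter_upwards [ae_restrict_mem measurableSet_Icc,
      ae_restrict_of_ae hn.ae_differentiableAt, ae_restrict_of_ae ha.ae_hasDerivAt_integral,
      ae_restrict_of_ae h0T] with t ht hdn hda hne
    rw [uIcc_of_le hT] at hdn hda
    have hdn := (hdn ht).hasDerivAt
    have hnhds : Icc 0 T ∈ 𝓝 t :=
      Icc_mem_nhds (lt_of_le_of_ne ht.1 hne.1.symm) (lt_of_le_of_ne ht.2 hne.2)
    have hdy : HasDerivAt y (a t) t := by
      refine ((hda ht 0 ⟨le_rfl, hT⟩).const_add (y 0)).congr_of_eventuallyEq ?_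
      filter_upwards [hnhds] with s hs using hy s hs
    -- at a zero of `y` the norm is minimal, hence has derivative zero
    have key : deriv (fun t => ‖y t‖) t ≤ -ρ * ‖y t‖ + b t := by
      by_cases h0 : y t = 0
      · have : IsLocalMin (fun t => ‖y t‖) t := Eventually.of_forall fun s => by simp [h0]
        rw [this.deriv_eq_zero, h0]
        simpa using hb0 t ht
      · have hpos : 0 < ‖y t‖ := norm_pos_iff.mpr h0
        have h1 := hdy.norm_sq
        have h2 := hdn.fun_pow 2
        have h3 := h1.unique h2
        have h4 := h t ht
        refine le_of_mul_le_mul_left ?_ hpos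
        simp at h3
        nlinarith
    rw [((hexp t).fun_mul hdn).deriv]
    have := mul_le_mul_of_nonneg_left key (Real.exp_pos (ρ * t)).le
    linarith
  rw [hI] at hle
  simp only [mul_zero, Real.exp_zero, one_mul] at hle
  have hE : ∫ τ in (0 : ℝ)..T, Real.exp (-ρ * (T - τ)) * b τ
      = Real.exp (-ρ * T) * ∫ τ in (0 : ℝ)..T, Real.exp (ρ * τ) * b τ := by
    rw [← intervalIntegral.integral_const_mul]
    congr 1; ext τ
    rw [← mul_assoc, ← Real.exp_add]; ring_nf
  rw [hE]
  have hc : Real.exp (-ρ * T) * Real.exp (ρ * T) = 1 := by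
    rw [← Real.exp_add]; simp
  have := mul_le_mul_of_nonneg_left hle (Real.exp_pos (-ρ * T)).le
  rw [mul_sub, ← mul_assoc, hc, one_mul] at this
  linarith

/-! ### Gradients of smooth convex functions -/

section Gradients

variable {E : Type*} [NormedAddCommGroup E] [InnerProductSpace ℝ E] [CompleteSpace E]

theorem _root_.HasGradientAt.hasDerivAt_comp_line {φ : E → ℝ} {G x d : E} {t : ℝ}
    (h : HasGradientAt φ G (x + t • d)) :
    HasDerivAt (fun s : ℝ => φ (x + s • d)) ⟪G, d⟫ t := by
  have h1 : HasDerivAt (fun s : ℝ => x + s • d) d t := by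
    simpa using ((hasDerivAt_id t).smul_const d).const_add x
  simpa [Function.comp_def] using h.hasFDerivAt.comp_hasDerivAt t h1

/-- The first-order characterization of convexity. -/
theorem _root_.ConvexOn.add_inner_le {φ : E → ℝ} (hφ : ConvexOn ℝ univ φ) {G x : E}
    (h : HasGradientAt φ G x) (y : E) : φ x + ⟪G, y - x⟫ ≤ φ y := by
  have h1 : ConvexOn ℝ univ (fun s : ℝ => φ (x + s • (y - x))) := by
    have := hφ.comp_affineMap (AffineMap.lineMap (k := ℝ) x y)
    refine this.congr fun s _ => ?_
    simp [AffineMap.lineMap_apply, add_comm]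
  have h2 : HasDerivAt (fun s : ℝ => φ (x + s • (y - x))) ⟪G, y - x⟫ 0 :=
    HasGradientAt.hasDerivAt_comp_line (by simpa using h)
  have h3 := h1.le_slope_of_hasDerivAt (mem_univ 0) (mem_univ 1) one_pos h2
  simp [slope_def_field] at h3
  linarith

/-- The descent lemma; only a one-sided Lipschitz bound on the gradient is needed. -/
theorem le_add_inner_add_sq {φ : E → ℝ} {G : E → E} {L : ℝ}
    (hG : ∀ x, HasGradientAt φ (G x) x)
    (hL : ∀ x y, ⟪G x - G y, x - y⟫ ≤ L * ‖x - y‖ ^ 2) (x y : E) :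
    φ y ≤ φ x + ⟪G x, y - x⟫ + L / 2 * ‖y - x‖ ^ 2 := by
  set d := y - x with hd
  have hder : ∀ t : ℝ, HasDerivAt
      (fun s : ℝ => φ (x + s • d) - s * ⟪G x, d⟫ - s ^ 2 * (L / 2 * ‖d‖ ^ 2))
      (⟪G (x + t • d), d⟫ - ⟪G x, d⟫ - 2 * t * (L / 2 * ‖d‖ ^ 2)) t := fun t => by
    have h1 := (HasGradientAt.hasDerivAt_comp_line (hG (x + t • d)))
    have h2 := (hasDerivAt_id t).mul_const ⟪G x, d⟫
    have h3 := (hasDerivAt_pow 2 t).mul_const (L / 2 * ‖d‖ ^ 2)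
    simpa using (h1.fun_sub h2).fun_sub h3
  have hanti : AntitoneOn
      (fun s : ℝ => φ (x + s • d) - s * ⟪G x, d⟫ - s ^ 2 * (L / 2 * ‖d‖ ^ 2)) (Icc 0 1) := by
    refine antitoneOn_of_deriv_nonpos (convex_Icc 0 1)
      (fun t _ => (hder t).continuousAt.continuousWithinAt)
      (fun t _ => (hder t).differentiableAt.differentiableWithinAt) fun t ht => ?_
    rw [interior_Icc] at ht
    rw [(hder t).deriv]
    have h1 := hL (x + t • d) x
    rw [add_sub_cancel_left, inner_smul_right, norm_smul, inner_sub_left, Real.norm_eq_abs,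
      mul_pow, sq_abs] at h1
    have h2 : ⟪G (x + t • d), d⟫ - ⟪G x, d⟫ ≤ L * t * ‖d‖ ^ 2 := by
      refine le_of_mul_le_mul_left ?_ ht.1
      linarith
    linarith
  have := hanti (left_mem_Icc.mpr zero_le_one) (right_mem_Icc.mpr zero_le_one) zero_le_one
  simp [hd] at this
  simp only [hd]
  linarith

/-- Cocoercivity of the gradient of a smooth convex function (Baillon–Haddad), also for `L = 0`. -/
theorem norm_sub_sq_le_mul_inner {φ : E → ℝ} {G : E → E} {L : ℝ} (hL0 : 0 ≤ L)
    (hφ : ConvexOn ℝ univ φ) (hG : ∀ x, HasGradientAt φ (G x) x)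
    (hL : ∀ x y, ⟪G x - G y, x - y⟫ ≤ L * ‖x - y‖ ^ 2) (x y : E) :
    ‖G x - G y‖ ^ 2 ≤ L * ⟪G x - G y, x - y⟫ := by
  -- the bound for every larger constant, which is then positive
  have key : ∀ K, L < K → ‖G x - G y‖ ^ 2 ≤ K * ⟪G x - G y, x - y⟫ := fun K hK => by
    have hK0 : 0 < K := hL0.trans_lt hK
    have hLK : ∀ x y, ⟪G x - G y, x - y⟫ ≤ K * ‖x - y‖ ^ 2 := fun x y =>
      (hL x y).trans (by gcongr)
    -- compare `φ` with its tangent at `x` in the point reached from `y` by a gradient step for the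
    -- tilted function `φ - ⟪G x, ·⟫`
    have half : ∀ x y, 1 / (2 * K) * ‖G x - G y‖ ^ 2 ≤ φ y - φ x - ⟪G x, y - x⟫ := fun x y => by
      have h1 := hφ.add_inner_le (hG x) (y + K⁻¹ • (G x - G y))
      have h2 := le_add_inner_add_sq hG hLK y (y + K⁻¹ • (G x - G y))
      rw [add_sub_cancel_left, inner_smul_right, norm_smul, mul_pow, Real.norm_eq_abs, sq_abs]
        at h2
      rw [add_sub_right_comm, inner_add_right, inner_smul_right] at h1
      have h3 : ⟪G x, G x - G y⟫ - ⟪G y, G x - G y⟫ = ‖G x - G y‖ ^ 2 := by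
        rw [← inner_sub_left, real_inner_self_eq_norm_sq]
      have h4 : K / 2 * (K⁻¹ ^ 2 * ‖G x - G y‖ ^ 2) = 1 / (2 * K) * ‖G x - G y‖ ^ 2 := by
        field_simp
      have h5 : 1 / (2 * K) * ‖G x - G y‖ ^ 2 = K⁻¹ * ‖G x - G y‖ ^ 2 / 2 := by
        field_simp
      rw [h4] at h2
      have h6 : K⁻¹ * ⟪G x, G x - G y⟫ - K⁻¹ * ⟪G y, G x - G y⟫ = K⁻¹ * ‖G x - G y‖ ^ 2 := by
        rw [← mul_sub, h3]
      linarith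
    have h1 := half x y
    have h2 := half y x
    have h3 : ⟪G x - G y, x - y⟫ = - ⟪G x, y - x⟫ - ⟪G y, x - y⟫ := by
      rw [inner_sub_left, ← neg_sub y x, inner_neg_right, inner_neg_right]
    rw [norm_sub_rev] at h2
    have h4 : 1 / (2 * K) * ‖G x - G y‖ ^ 2 * 2 ≤ ⟪G x - G y, x - y⟫ := by linarith
    calc ‖G x - G y‖ ^ 2 = K * (1 / (2 * K) * ‖G x - G y‖ ^ 2 * 2) := by field_simp
      _ ≤ _ := by gcongr
  refine ge_of_tendsto (f := fun K : ℝ => K * ⟪G x - G y, x - y⟫) (x := 𝓝[>] L) ?_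
    (eventually_mem_nhdsWithin.mono key)
  exact ((continuous_id.mul continuous_const).tendsto L).mono_left nhdsWithin_le_nhds

/-- Incremental sector bound for the gradient of a strongly convex smooth function, after
subtraction of the strongly convex part. -/
theorem norm_sub_sq_le_of_strongConvexOn {f : E → ℝ} {m L : ℝ} (hmL : m ≤ L)
    (hf : StrongConvexOn univ m f) (hL : HasLipschitzGradient L f) (x y : E) :
    ‖(gradient f x - gradient f y) - m • (x - y)‖ ^ 2 ≤
      (L - m) * ⟪(gradient f x - gradient f y) - m • (x - y), x - y⟫ := by
  have hconv := strongConvexOn_iff_convex.mp hf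
  have hG : ∀ x, HasGradientAt (fun x => f x - m / 2 * ‖x‖ ^ 2) (gradient f x - m • x) x := by
    intro x
    have h1 := (hL.1 x).hasGradientAt.hasFDerivAt
    have h2 := ((hasStrictFDerivAt_norm_sq x).hasFDerivAt).const_mul (m / 2)
    rw [hasGradientAt_iff_hasFDerivAt]
    refine (h1.sub h2).congr_fderiv ?_
    ext v
    simp
    ring
  have h := norm_sub_sq_le_mul_inner (sub_nonneg.mpr hmL) hconv hG (fun x y => ?_) x y
  · have e : gradient f x - m • x - (gradient f y - m • y)
        = (gradient f x - gradient f y) - m • (x - y) := by module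
    rwa [e] at h
  · have e : gradient f x - m • x - (gradient f y - m • y)
        = (gradient f x - gradient f y) - m • (x - y) := by module
    rw [e, inner_sub_left, real_inner_smul_left, real_inner_self_eq_norm_sq]
    have h1 := real_inner_le_norm (gradient f x - gradient f y) (x - y)
    have h2 := mul_le_mul_of_nonneg_right (hL.2 x y) (norm_nonneg (x - y))
    nlinarith

end Gradients

/-! ### The proximal operator and the Moreau envelope -/

section Moreau

variable {E : Type*} [NormedAddCommGroup E] [InnerProductSpace ℝ E]

namespace IsProperConvexLSC

variable {g : E → EReal} (hg : IsProperConvexLSC g)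
include hg

/-- Convexity along a segment, from convexity of the epigraph. -/
theorem le_of_le_of_le {x y : E} {a b s : ℝ} (hx : g x ≤ a) (hy : g y ≤ b) (hs0 : 0 ≤ s)
    (hs1 : s ≤ 1) : g (x + s • (y - x)) ≤ ((a + s * (b - a) : ℝ) : EReal) := by
  have h := hg.convex_epigraph (x := (x, a)) hx (y := (y, b)) hy (sub_nonneg.mpr hs1) hs0
    (sub_add_cancel 1 s)
  have e1 : (1 - s) • x + s • y = x + s • (y - x) := by module
  have e2 : (1 - s) * a + s * b = a + s * (b - a) := by ring
  simpa [e1, e2] using h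

/-- A proper convex lower semicontinuous function decreases at most linearly: it is bounded below
on a ball, and convexity propagates this bound along rays. -/
theorem exists_linear_lower_bound [FiniteDimensional ℝ E] {x₀ : E} {r : ℝ} (h₀ : g x₀ = r) :
    ∃ c K : ℝ, 0 ≤ K ∧ ∀ x, ((c - K * ‖x - x₀‖ : ℝ) : EReal) ≤ g x := by
  obtain ⟨xm, -, hmin⟩ := (hg.lsc.lowerSemicontinuousOn (Metric.closedBall x₀ 1)).exists_isMinOn
    ⟨x₀, by simp⟩ (isCompact_closedBall x₀ 1)
  have hm0 : g xm ≤ g x₀ := hmin (by simp)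
  obtain ⟨c, hc⟩ : ∃ c : ℝ, g xm = c :=
    ⟨(g xm).toReal, (EReal.coe_toReal (ne_top_of_le_ne_top (by simp [h₀]) hm0)
      (hg.ne_bot xm)).symm⟩
  have hcr : c ≤ r := by rw [hc, h₀] at hm0; exact_mod_cast hm0
  refine ⟨c, r - c, by linarith, fun x => ?_⟩
  by_cases hx : ‖x - x₀‖ ≤ 1
  · refine le_trans ?_ (hmin (by simpa [dist_eq_norm] using hx) : g xm ≤ g x)
    rw [hc]
    have : c - (r - c) * ‖x - x₀‖ ≤ c := by
      have := mul_nonneg (sub_nonneg.mpr hcr) (norm_nonneg (x - x₀)); linarith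
    exact_mod_cast this
  · push Not at hx
    by_cases htop : g x = ⊤
    · simp [htop]
    obtain ⟨b, hb⟩ : ∃ b : ℝ, g x = b := ⟨_, (EReal.coe_toReal htop (hg.ne_bot x)).symm⟩
    have hn : 0 < ‖x - x₀‖ := by linarith
    have h1 := hg.le_of_le_of_le h₀.le hb.le (inv_nonneg.mpr hn.le) (inv_le_one_of_one_le₀ hx.le)
    have h2 : g xm ≤ g (x₀ + ‖x - x₀‖⁻¹ • (x - x₀)) :=
      hmin (by simp [norm_smul, inv_mul_cancel₀ hn.ne'])
    have h3 := h2.trans h1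
    rw [hc] at h3
    have h4 : c ≤ r + ‖x - x₀‖⁻¹ * (b - r) := by exact_mod_cast h3
    have h5 := mul_le_mul_of_nonneg_left h4 hn.le
    rw [mul_add, ← mul_assoc, mul_inv_cancel₀ hn.ne', one_mul] at h5
    rw [hb]
    have h6 : c - (r - c) * ‖x - x₀‖ ≤ b := by nlinarith
    exact_mod_cast h6

/-- Existence of proximal points, by the direct method. -/
theorem exists_isProx [FiniteDimensional ℝ E] {μ : ℝ} (hμ : 0 < μ) (v : E) :
    ∃ x, IsProx μ g v x := by
  obtain ⟨x₀, hx₀⟩ := hg.exists_ne_top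
  obtain ⟨r, hr⟩ : ∃ r : ℝ, g x₀ = r := ⟨_, (EReal.coe_toReal hx₀ (hg.ne_bot x₀)).symm⟩
  obtain ⟨c, K, hK, hlow⟩ := hg.exists_linear_lower_bound hr
  set F : E → EReal := fun x => g x + ((1 / (2 * μ) * ‖x - v‖ ^ 2 : ℝ) : EReal) with hF
  have hFlsc : LowerSemicontinuous F := by
    refine hg.lsc.add' (Continuous.lowerSemicontinuous ?_) fun x =>
      EReal.continuousAt_add (Or.inr (EReal.coe_ne_bot _)) (Or.inr (EReal.coe_ne_top _))
    exact continuous_coe_real_ereal.comp (by fun_prop)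
  -- outside a ball of radius `R` about `v` the objective exceeds its value at `x₀`
  set A : ℝ := r + 1 / (2 * μ) * ‖x₀ - v‖ ^ 2 - c + K * ‖v - x₀‖ with hA
  set R : ℝ := max (max 1 ‖x₀ - v‖) (2 * μ * (K + |A| + 1)) with hR
  have hR1 : 1 ≤ R := (le_max_left _ _).trans (le_max_left _ _)
  have hx₀R : x₀ ∈ Metric.closedBall v R := by
    rw [mem_closedBall_iff_norm]
    exact (le_max_right _ _).trans (le_max_left _ _)
  obtain ⟨x, -, hmin⟩ := (hFlsc.lowerSemicontinuousOn (Metric.closedBall v R)).exists_isMinOn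
    ⟨x₀, hx₀R⟩ (isCompact_closedBall v R)
  refine ⟨x, fun y => ?_⟩
  by_cases hy : y ∈ Metric.closedBall v R
  · exact hmin hy
  refine (hmin hx₀R : F x ≤ F x₀).trans ?_
  rw [mem_closedBall_iff_norm, not_le] at hy
  have h2 : ((c - K * ‖y - x₀‖ + 1 / (2 * μ) * ‖y - v‖ ^ 2 : ℝ) : EReal) ≤ F y := by
    rw [EReal.coe_add]
    exact add_le_add (hlow y) le_rfl
  refine le_trans ?_ h2
  simp only [hF, hr]
  rw [← EReal.coe_add, EReal.coe_le_coe_iff]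
  have h3 : ‖y - x₀‖ ≤ ‖y - v‖ + ‖v - x₀‖ := norm_sub_le_norm_sub_add_norm_sub _ _ _
  have h4 : 2 * μ * (K + |A| + 1) ≤ ‖y - v‖ := (le_max_right _ _).trans hy.le
  have h5 : K + |A| + 1 ≤ 1 / (2 * μ) * ‖y - v‖ := by
    rw [one_div, ← div_eq_inv_mul, le_div_iff₀ (by positivity)]; linarith
  have h6 : 1 ≤ ‖y - v‖ := hR1.trans hy.le
  have h7 : (K + |A|) * ‖y - v‖ ≤ 1 / (2 * μ) * ‖y - v‖ ^ 2 := by nlinarith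
  have h8 : A ≤ |A| * ‖y - v‖ := (le_abs_self A).trans (le_mul_of_one_le_right (abs_nonneg A) h6)
  have h9 := mul_le_mul_of_nonneg_left h3 hK
  linarith

theorem isProx_prox [FiniteDimensional ℝ E] {μ : ℝ} (hμ : 0 < μ) (v : E) :
    IsProx μ g v (prox μ g v) :=
  Classical.epsilon_spec (hg.exists_isProx hμ v)

theorem coe_toReal_prox [FiniteDimensional ℝ E] {μ : ℝ} (hμ : 0 < μ) (v : E) :
    ((g (prox μ g v)).toReal : EReal) = g (prox μ g v) := by
  refine EReal.coe_toReal (fun htop => ?_) (hg.ne_bot _)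
  obtain ⟨x₀, hx₀⟩ := hg.exists_ne_top
  have h := hg.isProx_prox hμ v x₀
  rw [htop, EReal.top_add_coe, top_le_iff] at h
  exact (EReal.add_ne_top hx₀ (EReal.coe_ne_top _)) h

/-- The Moreau envelope is the minimal value of the proximal objective. -/
theorem moreau_le [FiniteDimensional ℝ E] {μ : ℝ} (hμ : 0 < μ) (v : E) {x : E} {a : ℝ}
    (hx : g x ≤ a) : moreau μ g v ≤ a + 1 / (2 * μ) * ‖x - v‖ ^ 2 := by
  have h := (hg.isProx_prox hμ v x).trans (add_le_add_left hx _)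
  rw [← hg.coe_toReal_prox hμ v] at h
  exact_mod_cast h

/-- The first-order optimality condition for the proximal point: `(v - prox v) / μ` is a
subgradient of `g` at `prox v`. -/
theorem prox_add_inner_le [FiniteDimensional ℝ E] {μ : ℝ} (hμ : 0 < μ) (v : E) {y : E} {b : ℝ}
    (hy : g y ≤ b) :
    (g (prox μ g v)).toReal + μ⁻¹ * ⟪v - prox μ g v, y - prox μ g v⟫ ≤ b := by
  set x := prox μ g v with hx
  set a := (g x).toReal with ha
  have hga : g x = a := (hg.coe_toReal_prox hμ v).symm
  have key : ∀ s ∈ Ioo (0 : ℝ) 1,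
      a + μ⁻¹ * ⟪v - x, y - x⟫ ≤ b + s * (1 / (2 * μ) * ‖y - x‖ ^ 2) := fun s hs => by
    have h1 := hg.moreau_le hμ v (hg.le_of_le_of_le hga.le hy hs.1.le hs.2.le)
    simp only [moreau, ← hx, ← ha] at h1
    have e : x + s • (y - x) - v = s • (y - x) - (v - x) := by abel
    rw [e, norm_sub_sq_real (s • (y - x)), norm_smul, real_inner_smul_left, real_inner_comm, mul_pow,
      Real.norm_eq_abs, sq_abs, norm_sub_rev x v] at h1
    refine le_of_mul_le_mul_left ?_ hs.1
    have e2 : μ⁻¹ = 2 * (1 / (2 * μ)) := by field_simp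
    rw [e2]
    linarith
  refine ge_of_tendsto (f := fun s : ℝ => b + s * (1 / (2 * μ) * ‖y - x‖ ^ 2)) (x := 𝓝[>] 0) ?_
    (mem_of_superset (Ioo_mem_nhdsGT one_pos) key)
  have : Continuous fun s : ℝ => b + s * (1 / (2 * μ) * ‖y - x‖ ^ 2) := by fun_prop
  simpa using (this.tendsto 0).mono_left nhdsWithin_le_nhds

/-- Firm nonexpansiveness of `v ↦ v - prox v`. -/
theorem norm_sub_prox_sq_le [FiniteDimensional ℝ E] {μ : ℝ} (hμ : 0 < μ) (v w : E) :
    ‖(v - prox μ g v) - (w - prox μ g w)‖ ^ 2 ≤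
      ⟪(v - prox μ g v) - (w - prox μ g w), v - w⟫ := by
  have h1 := hg.prox_add_inner_le hμ v (hg.coe_toReal_prox hμ w).ge
  have h2 := hg.prox_add_inner_le hμ w (hg.coe_toReal_prox hμ v).ge
  have h3 : 0 ≤ ⟪(v - prox μ g v) - (w - prox μ g w), prox μ g v - prox μ g w⟫ := by
    have h4 : μ⁻¹ * (⟪v - prox μ g v, prox μ g w - prox μ g v⟫ +
        ⟪w - prox μ g w, prox μ g v - prox μ g w⟫) ≤ 0 := by linarith
    have h5 := nonpos_of_mul_nonpos_right h4 (inv_pos.mpr hμ)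
    rw [← neg_sub (prox μ g v) (prox μ g w), inner_neg_right] at h5
    rw [inner_sub_left]; linarith
  have e : v - w = ((v - prox μ g v) - (w - prox μ g w)) + (prox μ g v - prox μ g w) := by abel
  conv_rhs => rw [e, inner_add_right, real_inner_self_eq_norm_sq]
  linarith

/-- A quadratic upper bound for the Moreau envelope. With the roles of the two points exchanged it
also bounds the envelope from below, which gives the gradient. -/
theorem moreau_le_add_inner [FiniteDimensional ℝ E] {μ : ℝ} (hμ : 0 < μ) (v w : E) :
    moreau μ g w ≤ moreau μ g v + ⟪μ⁻¹ • (v - prox μ g v), w - v⟫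
      + 1 / (2 * μ) * ‖w - v‖ ^ 2 := by
  have h := hg.moreau_le hμ w (hg.coe_toReal_prox hμ v).ge
  refine h.trans (le_of_eq ?_)
  have e : prox μ g v - w = -((v - prox μ g v) + (w - v)) := by abel
  rw [moreau, e, norm_neg, norm_add_sq_real, norm_sub_rev (prox μ g v) v, real_inner_smul_left]
  field_simp
  ring

theorem hasGradientAt_moreau [FiniteDimensional ℝ E] [CompleteSpace E] {μ : ℝ} (hμ : 0 < μ)
    (v : E) : HasGradientAt (moreau μ g) (μ⁻¹ • (v - prox μ g v)) v := by
  rw [hasGradientAt_iff_isLittleO]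
  refine Asymptotics.IsBigO.trans_isLittleO (g := fun w => ‖w - v‖ ^ 2) ?_ ?_
  · refine Asymptotics.IsBigO.of_bound (2 * μ⁻¹) (Eventually.of_forall fun w => ?_)
    have h1 := hg.moreau_le_add_inner hμ v w
    have h2 := hg.moreau_le_add_inner hμ w v
    have h3 := hg.norm_sub_prox_sq_le hμ w v
    have h6 : 0 ≤ ⟪(w - prox μ g w) - (v - prox μ g v), w - v⟫ := (sq_nonneg _).trans h3
    rw [inner_sub_left] at h6
    rw [norm_sub_rev v w, ← neg_sub w v, inner_neg_right, real_inner_smul_left] at h2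
    rw [real_inner_smul_left] at h1 ⊢
    have hi := inv_pos.mpr hμ
    have h7 := mul_nonneg hi.le h6
    have h8 := mul_nonneg hi.le (sq_nonneg ‖w - v‖)
    have e : 1 / (2 * μ) * ‖w - v‖ ^ 2 = μ⁻¹ * ‖w - v‖ ^ 2 / 2 := by field_simp
    rw [e] at h1 h2
    rw [norm_pow, norm_norm, Real.norm_eq_abs, abs_le]
    constructor <;> linarith
  · have h : Tendsto (fun w : E => w - v) (𝓝 v) (𝓝 0) := by
      have : Continuous fun w : E => w - v := by fun_prop
      simpa using this.tendsto v
    exact (Asymptotics.isLittleO_norm_pow_id one_lt_two).comp_tendsto h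

/-- Incremental sector bound for `μ ∇M`, where `M` is the Moreau envelope: its slope lies in
`[0, 1]`. -/
theorem norm_sub_sq_le_inner_gradient_moreau [FiniteDimensional ℝ E] [CompleteSpace E] {μ : ℝ}
    (hμ : 0 < μ) (v w : E) :
    ‖μ • (gradient (moreau μ g) v - gradient (moreau μ g) w)‖ ^ 2 ≤
      ⟪μ • (gradient (moreau μ g) v - gradient (moreau μ g) w), v - w⟫ := by
  rw [(hg.hasGradientAt_moreau hμ v).gradient, (hg.hasGradientAt_moreau hμ w).gradient,
    ← smul_sub, smul_inv_smul₀ hμ.ne']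
  exact hg.norm_sub_prox_sq_le hμ v w

end IsProperConvexLSC
end Moreau

/-! ### The Lyapunov inequality -/

section Lyapunov

variable {X : Type*} [Fintype X] [DecidableEq X]

open scoped Matrix.Norms.L2Operator in
/-- A consequence of Gelfand's formula. -/
theorem exists_norm_pow_lt_one (N : Matrix X X ℂ) (h : ∀ z ∈ spectrum ℂ N, ‖z‖ < 1) :
    ∃ k : ℕ, 0 < k ∧ ‖N ^ k‖ < 1 := by
  cases isEmpty_or_nonempty X
  · exact ⟨1, one_pos, by simp [Subsingleton.elim N 0]⟩
  have hr : spectralRadius ℂ N < ((1 : NNReal) : ENNReal) :=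
    spectrum.spectralRadius_lt_of_forall_lt N fun z hz => by
      exact_mod_cast h z hz
  have h1 := (spectrum.pow_nnnorm_pow_one_div_tendsto_nhds_spectralRadius N).eventually
    (gt_mem_nhds hr)
  obtain ⟨k, hk, hk0⟩ := (h1.and (eventually_gt_atTop 0)).exists
  refine ⟨k, hk0, ?_⟩
  by_contra! hge
  refine hk.not_ge (ENNReal.one_le_rpow ?_ (by positivity))
  exact_mod_cast hge

open scoped Matrix.Norms.L2Operator in
theorem posDef_one_sub_pow_transpose_mul_pow {M : Matrix X X ℝ} {k : ℕ}
    (hk : ‖(M.map (fun r : ℝ => (r : ℂ))) ^ k‖ < 1) :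
    (1 - (M ^ k)ᵀ * M ^ k).PosDef := by
  refine PosDef.of_dotProduct_mulVec_pos ?_ fun x hx => ?_
  · simp [IsHermitian, conjTranspose_eq_transpose_of_trivial]
  have e : (M.map (fun r : ℝ => (r : ℂ))) ^ k *ᵥ (fun i => (x i : ℂ))
      = fun i => (((M ^ k) *ᵥ x) i : ℂ) := by
    have h1 : (M.map (fun r : ℝ => (r : ℂ))) ^ k = (M ^ k).map Complex.ofRealHom :=
      (map_pow (Complex.ofRealHom.mapMatrix) M k).symm
    rw [h1]
    ext i
    exact (RingHom.map_mulVec Complex.ofRealHom (M ^ k) x i).symm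
  have h1 := l2_opNorm_mulVec ((M.map (fun r : ℝ => (r : ℂ))) ^ k)
    (WithLp.toLp 2 fun i => (x i : ℂ))
  have hn : ∀ y : X → ℝ, ‖(WithLp.toLp 2 fun i => (y i : ℂ) : EuclideanSpace ℂ X)‖ ^ 2
      = y ⬝ᵥ y := fun y => by
    rw [EuclideanSpace.norm_sq_eq]
    simp [dotProduct, pow_two]
  have h2 : ‖(WithLp.toLp 2 fun i => (((M ^ k) *ᵥ x) i : ℂ) : EuclideanSpace ℂ X)‖
      ≤ ‖(M.map (fun r : ℝ => (r : ℂ))) ^ k‖ *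
        ‖(WithLp.toLp 2 fun i => (x i : ℂ) : EuclideanSpace ℂ X)‖ := by
    rw [← e]; exact h1
  have hpos : 0 < ‖(WithLp.toLp 2 fun i => (x i : ℂ) : EuclideanSpace ℂ X)‖ := by
    rw [norm_pos_iff]
    intro h0
    refine hx (funext fun i => ?_)
    have := congrArg (fun v : EuclideanSpace ℂ X => v i) h0
    simpa using this
  have h3 : ‖(WithLp.toLp 2 fun i => (((M ^ k) *ᵥ x) i : ℂ) : EuclideanSpace ℂ X)‖
      < ‖(WithLp.toLp 2 fun i => (x i : ℂ) : EuclideanSpace ℂ X)‖ :=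
    h2.trans_lt (mul_lt_of_lt_one_left hpos hk)
  have h4 := pow_lt_pow_left₀ h3 (norm_nonneg _) two_ne_zero
  rw [hn, hn] at h4
  rw [sub_mulVec, dotProduct_sub, one_mulVec, ← mulVec_mulVec, star_trivial, dotProduct_mulVec,
    vecMul_transpose]
  linarith

/-- Solvability of a Stein inequality: if some power of `M` is a contraction, then a finite sum of
the matrices `(M ^ i)ᵀ M ^ i` does it. -/
theorem exists_posDef_stein {M : Matrix X X ℝ}
    (h : ∀ z ∈ spectrum ℂ (M.map (fun r : ℝ => (r : ℂ))), ‖z‖ < 1) :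
    ∃ R : Matrix X X ℝ, R.PosDef ∧ (R - Mᵀ * R * M).PosDef := by
  obtain ⟨k, hk0, hk⟩ := exists_norm_pow_lt_one _ h
  refine ⟨∑ i ∈ Finset.range k, (M ^ i)ᵀ * M ^ i, ?_, ?_⟩
  · obtain ⟨j, rfl⟩ : ∃ j, k = j + 1 := ⟨k - 1, by omega⟩
    rw [Finset.sum_range_succ']
    refine PosDef.posSemidef_add (posSemidef_sum _ fun i _ => ?_) ?_
    · simpa [conjTranspose_eq_transpose_of_trivial] using
        posSemidef_conjTranspose_mul_self (M ^ (i + 1))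
    · simpa using PosDef.one
  · have e : ∀ j : ℕ, ∑ i ∈ Finset.range j, (M ^ i)ᵀ * M ^ i
        - Mᵀ * (∑ i ∈ Finset.range j, (M ^ i)ᵀ * M ^ i) * M = 1 - (M ^ j)ᵀ * M ^ j := fun j => by
      induction j with
      | zero => simp
      | succ j ih =>
        have e1 : Mᵀ * ((M ^ j)ᵀ * M ^ j) * M = (M ^ (j + 1))ᵀ * M ^ (j + 1) := by
          rw [pow_succ, transpose_mul]; simp only [Matrix.mul_assoc]
        rw [Finset.sum_range_succ, Matrix.mul_add, Matrix.add_mul, e1]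
        rw [add_sub_add_comm, ih]; abel
    rw [e]
    exact posDef_one_sub_pow_transpose_mul_pow hk

theorem isUnit_of_isUnit_map_ofReal {D : Matrix X X ℝ}
    (h : IsUnit (D.map (fun r : ℝ => (r : ℂ)))) : IsUnit D := by
  rw [isUnit_iff_isUnit_det, isUnit_iff_ne_zero] at h ⊢
  have e : (D.map (fun r : ℝ => (r : ℂ))).det = (D.det : ℂ) :=
    (RingHom.map_det Complex.ofRealHom D).symm
  rw [e] at h
  exact_mod_cast h

/-- The inverse Cayley transform maps the open left half plane into the open unit disc. -/
theorem norm_lt_one_of_cayley_re_neg {z : ℂ} (hz : z ≠ 1) (h : ((z + 1) / (z - 1)).re < 0) :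
    ‖z‖ < 1 := by
  have h0 : 0 < Complex.normSq (z - 1) := Complex.normSq_pos.mpr (sub_ne_zero.mpr hz)
  rw [Complex.div_re, ← add_div, div_neg_iff] at h
  have h1 := (h.resolve_left fun h => absurd h.2 h0.not_gt).1
  simp at h1
  have h2 : ‖z‖ ^ 2 < 1 := by
    rw [Complex.sq_norm, Complex.normSq_apply]; nlinarith
  nlinarith [norm_nonneg z]

/-- Lyapunov's theorem. The Cayley transform `M = (A + I)(A - I)⁻¹` has its spectrum in the open
unit disc, and a solution of the Stein inequality for `M` solves the Lyapunov inequality for `A`. -/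
theorem IsHurwitz.exists_posDef_lyapunov {A : Matrix X X ℝ} (hA : IsHurwitz A) :
    ∃ R : Matrix X X ℝ, R.PosDef ∧ (-(Aᵀ * R + R * A)).PosDef := by
  set Ac := A.map (fun r : ℝ => (r : ℂ)) with hAc
  have hmap1 : ∀ N₁ N₂ : Matrix X X ℝ, (N₁ * N₂).map (fun r : ℝ => (r : ℂ))
      = N₁.map (fun r : ℝ => (r : ℂ)) * N₂.map (fun r : ℝ => (r : ℂ)) := fun N₁ N₂ =>
    Matrix.map_mul (f := Complex.ofRealHom)
  have hone : (1 : Matrix X X ℝ).map (fun r : ℝ => (r : ℂ)) = 1 :=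
    map_one (Complex.ofRealHom.mapMatrix)
  have hDc : (A - 1).map (fun r : ℝ => (r : ℂ)) = Ac - 1 := by
    rw [← hone]; exact Matrix.map_sub _ Complex.ofReal_sub A 1
  have hAc1 : (A + 1).map (fun r : ℝ => (r : ℂ)) = Ac + 1 := by
    rw [← hone]; exact Matrix.map_add _ Complex.ofReal_add A 1
  have hD : IsUnit (A - 1) := by
    apply isUnit_of_isUnit_map_ofReal
    rw [hDc]
    by_contra h
    have : (1 : ℂ) ∈ spectrum ℂ Ac := by
      rw [spectrum.mem_iff, map_one]
      intro h1
      exact h (by simpa using h1.neg)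
    have := hA 1 this
    simp at this
    linarith
  have hDdet : IsUnit (A - 1).det := (isUnit_iff_isUnit_det _).mp hD
  obtain ⟨M, hM⟩ : ∃ M : Matrix X X ℝ, M * (A - 1) = A + 1 :=
    ⟨(A + 1) * (A - 1)⁻¹, nonsing_inv_mul_cancel_right _ _ hDdet⟩
  have hMc : M.map (fun r : ℝ => (r : ℂ)) * (Ac - 1) = Ac + 1 := by
    rw [← hDc, ← hmap1, hM, hAc1]
  obtain ⟨R, hR, hS⟩ := exists_posDef_stein (M := M) fun z hz => by
    set Mc := M.map (fun r : ℝ => (r : ℂ))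
    rw [spectrum.mem_iff] at hz
    have hDcu : IsUnit (Ac - 1) := by
      rw [← hDc]; exact hD.map (Complex.ofRealHom.mapMatrix)
    have e : (algebraMap ℂ (Matrix X X ℂ) z - Mc) * (Ac - 1)
        = (z - 1) • Ac - (z + 1) • (1 : Matrix X X ℂ) := by
      rw [sub_mul, hMc, Algebra.algebraMap_eq_smul_one, smul_mul_assoc, one_mul]
      module
    have hnu : ¬ IsUnit ((z - 1) • Ac - (z + 1) • (1 : Matrix X X ℂ)) := by
      rw [← e]
      intro h
      exact hz ((IsUnit.mul_right_iff hDcu).mp h)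
    have hz1 : z ≠ 1 := by
      rintro rfl
      apply hnu
      rw [sub_self, zero_smul, zero_sub, ← neg_smul]
      exact (isUnit_one (M := Matrix X X ℂ)).smul (Units.mk0 (-(1 + 1) : ℂ) (by norm_num))
    refine norm_lt_one_of_cayley_re_neg hz1 (hA _ ?_)
    rw [spectrum.mem_iff]
    intro h
    apply hnu
    have hz' : z - 1 ≠ 0 := sub_ne_zero.mpr hz1
    have e2 : (z - 1) • Ac - (z + 1) • (1 : Matrix X X ℂ)
        = (Units.mk0 (-(z - 1)) (neg_ne_zero.mpr hz')) •
          (algebraMap ℂ (Matrix X X ℂ) ((z + 1) / (z - 1)) - Ac) := by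
      rw [Algebra.algebraMap_eq_smul_one, Units.smul_mk0, smul_sub, smul_smul, neg_mul,
        mul_div_cancel₀ _ hz']
      module
    rw [e2]
    exact h.smul _
  refine ⟨R, hR, ?_⟩
  -- `(A - I)ᵀ R (A - I) - (A + I)ᵀ R (A + I) = -2 (Aᵀ R + R A)`
  have e : -(Aᵀ * R + R * A) = (2⁻¹ : ℝ) • ((A - 1)ᴴ * (R - Mᵀ * R * M) * (A - 1)) := by
    have h1 : (A - 1)ᴴ * (R - Mᵀ * R * M) * (A - 1)
        = (A - 1)ᵀ * R * (A - 1) - (M * (A - 1))ᵀ * R * (M * (A - 1)) := by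
      rw [conjTranspose_eq_transpose_of_trivial, transpose_mul]
      noncomm_ring
    rw [h1, hM, transpose_sub, transpose_add, transpose_one]
    have h2 : (Aᵀ - 1) * R * (A - 1) - (Aᵀ + 1) * R * (A + 1) = (2 : ℝ) • -(Aᵀ * R + R * A) := by
      rw [two_smul]
      noncomm_ring
    rw [h2, smul_smul]; norm_num
  rw [e]
  exact (hS.conjTranspose_mul_mul_same (mulVec_injective_of_isUnit hD)).smul (by norm_num)

end Lyapunov

/-! ### Perturbation of quadratic forms -/

section Perturbation

/-- Small perturbations of a nonpositive quadratic form `N`: if `D` is negative on the kernel of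
`N`, then `N + δ D` is negative definite for all small `δ > 0`. Stated for continuous functions that
are homogeneous of degree two. -/
theorem eventually_forall_add_mul_neg {V : Type*} [NormedAddCommGroup V] [NormedSpace ℝ V]
    [FiniteDimensional ℝ V] {N D : V → ℝ} (hN : Continuous N) (hD : Continuous D)
    (hN2 : ∀ (c : ℝ) v, N (c • v) = c ^ 2 * N v) (hD2 : ∀ (c : ℝ) v, D (c • v) = c ^ 2 * D v)
    (hN0 : ∀ v, N v ≤ 0) (h : ∀ v, v ≠ 0 → N v = 0 → D v < 0) :
    ∀ᶠ δ in 𝓝[>] (0 : ℝ), ∀ v, v ≠ 0 → N v + δ * D v < 0 := by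
  have : ProperSpace V := FiniteDimensional.proper ℝ V
  -- by homogeneity it suffices to treat the unit sphere
  suffices hs : ∀ᶠ δ in 𝓝[>] (0 : ℝ), ∀ v ∈ Metric.sphere (0 : V) 1, N v + δ * D v < 0 by
    filter_upwards [hs] with δ hδ v hv
    have hn : 0 < ‖v‖ := norm_pos_iff.mpr hv
    have h1 := hδ (‖v‖⁻¹ • v) (by simp [norm_smul, hn.ne'])
    rw [hN2, hD2] at h1
    have h2 : ‖v‖⁻¹ ^ 2 * (N v + δ * D v) < 0 := by linarith
    exact neg_of_mul_neg_right h2 (by positivity)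
  have hS : IsCompact (Metric.sphere (0 : V) 1) := isCompact_sphere 0 1
  have hK : IsCompact (Metric.sphere (0 : V) 1 ∩ {v | 0 ≤ D v}) :=
    hS.inter_right (isClosed_le continuous_const hD)
  obtain ⟨b, hb⟩ := (hS.image hD).bddAbove
  have hb' : ∀ v ∈ Metric.sphere (0 : V) 1, D v ≤ b := fun v hv => hb (mem_image_of_mem D hv)
  obtain ⟨a, ha, hNa⟩ : ∃ a > 0, ∀ v ∈ Metric.sphere (0 : V) 1 ∩ {v | 0 ≤ D v}, N v ≤ -a := by
    rcases (Metric.sphere (0 : V) 1 ∩ {v | 0 ≤ D v}).eq_empty_or_nonempty with h0 | h0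
    · exact ⟨1, one_pos, by simp [h0]⟩
    obtain ⟨v, hv, hmax⟩ := hK.exists_isMaxOn h0 hN.continuousOn
    refine ⟨-N v, ?_, fun w hw => by rw [neg_neg]; exact hmax hw⟩
    have hv0 : v ≠ 0 := fun h0 => by simpa [h0] using hv.1
    have : N v ≠ 0 := fun h1 => (h v hv0 h1).not_ge hv.2
    exact neg_pos.mpr (lt_of_le_of_ne (hN0 v) this)
  have hδ0 : 0 < a / (|b| + 1) := by positivity
  filter_upwards [Ioo_mem_nhdsGT hδ0] with δ hδ v hv
  by_cases hDv : 0 ≤ D v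
  · have h1 := hNa v ⟨hv, hDv⟩
    have h2 : δ * (|b| + 1) < a := (lt_div_iff₀ (by positivity)).mp hδ.2
    have h3 : δ * D v ≤ δ * (|b| + 1) := by
      refine mul_le_mul_of_nonneg_left ?_ hδ.1.le
      linarith [hb' v hv, le_abs_self b]
    linarith
  · push Not at hDv
    linarith [hN0 v, mul_neg_of_pos_of_neg hδ.1 hDv]

end Perturbation

/-! ### Block matrices and the LMI as a dissipation inequality -/

section Blocks

theorem blocks3_mulVec {r₁ r₂ r₃ c₁ c₂ c₃ : Type*} [Fintype c₁] [Fintype c₂] [Fintype c₃]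
    (M₁₁ : Matrix r₁ c₁ ℝ) (M₁₂ : Matrix r₁ c₂ ℝ) (M₁₃ : Matrix r₁ c₃ ℝ)
    (M₂₁ : Matrix r₂ c₁ ℝ) (M₂₂ : Matrix r₂ c₂ ℝ) (M₂₃ : Matrix r₂ c₃ ℝ)
    (M₃₁ : Matrix r₃ c₁ ℝ) (M₃₂ : Matrix r₃ c₂ ℝ) (M₃₃ : Matrix r₃ c₃ ℝ)
    (a : c₁ → ℝ) (b : c₂ → ℝ) (c : c₃ → ℝ) :
    blocks3 M₁₁ M₁₂ M₁₃ M₂₁ M₂₂ M₂₃ M₃₁ M₃₂ M₃₃ *ᵥ Sum.elim a (Sum.elim b c) =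
      Sum.elim (M₁₁ *ᵥ a + M₁₂ *ᵥ b + M₁₃ *ᵥ c)
        (Sum.elim (M₂₁ *ᵥ a + M₂₂ *ᵥ b + M₂₃ *ᵥ c) (M₃₁ *ᵥ a + M₃₂ *ᵥ b + M₃₃ *ᵥ c)) := by
  simp [blocks3, fromBlocks_mulVec, fromCols_mulVec, fromRows_mulVec, Sum.elim_add_add, add_assoc]

theorem blocks3_transpose {r₁ r₂ r₃ c₁ c₂ c₃ : Type*}
    (M₁₁ : Matrix r₁ c₁ ℝ) (M₁₂ : Matrix r₁ c₂ ℝ) (M₁₃ : Matrix r₁ c₃ ℝ)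
    (M₂₁ : Matrix r₂ c₁ ℝ) (M₂₂ : Matrix r₂ c₂ ℝ) (M₂₃ : Matrix r₂ c₃ ℝ)
    (M₃₁ : Matrix r₃ c₁ ℝ) (M₃₂ : Matrix r₃ c₂ ℝ) (M₃₃ : Matrix r₃ c₃ ℝ) :
    (blocks3 M₁₁ M₁₂ M₁₃ M₂₁ M₂₂ M₂₃ M₃₁ M₃₂ M₃₃)ᵀ =
      blocks3 M₁₁ᵀ M₂₁ᵀ M₃₁ᵀ M₁₂ᵀ M₂₂ᵀ M₃₂ᵀ M₁₃ᵀ M₂₃ᵀ M₃₃ᵀ := by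
  simp [blocks3, fromBlocks_transpose, transpose_fromCols, transpose_fromRows]

theorem exists_eq_sumElim_sumElim {r₁ r₂ r₃ : Type*} (z : r₁ ⊕ (r₂ ⊕ r₃) → ℝ) :
    ∃ a b c, z = Sum.elim a (Sum.elim b c) :=
  ⟨fun i => z (.inl i), fun i => z (.inr (.inl i)), fun i => z (.inr (.inr i)), by
    ext (i | i | i) <;> rfl⟩

theorem multiplier_transpose (U Y₁ Y₂ : Type*) [DecidableEq U] [DecidableEq Y₁] [DecidableEq Y₂]
    (Lhat Lh φ₁ φ₂ : ℝ) :
    (multiplier U Y₁ Y₂ Lhat Lh φ₁ φ₂)ᵀ = multiplier U Y₁ Y₂ Lhat Lh φ₁ φ₂ := by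
  simp [multiplier, fromBlocks_transpose, blocks3_transpose]

/-- The quadratic form of the multiplier is a weighted sum of sector terms `L ⟨y, p⟩ - ‖p‖²`. -/
theorem dotProduct_multiplier_mulVec {U Y₁ Y₂ : Type*} [Fintype U] [Fintype Y₁] [Fintype Y₂]
    [DecidableEq U] [DecidableEq Y₁] [DecidableEq Y₂] (Lhat Lh φ₁ φ₂ : ℝ)
    (y₁ p₁ : U → ℝ) (y₂ p₂ : Y₁ → ℝ) (y₃ p₃ : Y₂ → ℝ) :
    Sum.elim (Sum.elim y₁ (Sum.elim y₂ y₃)) (Sum.elim p₁ (Sum.elim p₂ p₃)) ⬝ᵥ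
      multiplier U Y₁ Y₂ Lhat Lh φ₁ φ₂ *ᵥ
        Sum.elim (Sum.elim y₁ (Sum.elim y₂ y₃)) (Sum.elim p₁ (Sum.elim p₂ p₃)) =
    2 * (φ₁ * (Lhat * (y₁ ⬝ᵥ p₁) - p₁ ⬝ᵥ p₁) + φ₂ * (Lh * (y₂ ⬝ᵥ p₂) - p₂ ⬝ᵥ p₂)
      + (y₃ ⬝ᵥ p₃ - p₃ ⬝ᵥ p₃)) := by
  simp only [multiplier, fromBlocks_mulVec, blocks3_mulVec, sumElim_dotProduct_sumElim,
    Sum.elim_comp_inl, Sum.elim_comp_inr, zero_mulVec, smul_mulVec, one_mulVec, zero_add, add_zero,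
    dotProduct_add, dotProduct_smul, smul_eq_mul, ← Sum.elim_add_add]
  rw [dotProduct_comm p₁ y₁, dotProduct_comm p₂ y₂, dotProduct_comm p₃ y₃]
  ring

/-- The LMI as a dissipation inequality for the storage function `z ↦ z ⬝ P z`. -/
theorem satisfiesLMI_iff {z v : Type*} [Fintype z] [Fintype v] [DecidableEq v]
    {A : Matrix z z ℝ} {B : Matrix z v ℝ} {C : Matrix v z ℝ}
    {P : Matrix z z ℝ} {Ξ : Matrix (v ⊕ v) (v ⊕ v) ℝ} (hP : Pᵀ = P) (hΞ : Ξᵀ = Ξ) :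
    SatisfiesLMI A B C P Ξ ↔ ∀ (x : z → ℝ) (p : v → ℝ),
      2 * ((P *ᵥ x) ⬝ᵥ (A *ᵥ x + B *ᵥ p)) +
        Sum.elim (C *ᵥ x) p ⬝ᵥ Ξ *ᵥ Sum.elim (C *ᵥ x) p ≤ 0 := by
  have hsym : (-(fromBlocks (Aᵀ * P + P * A) (P * B) (Bᵀ * P) 0 +
      fromBlocks Cᵀ 0 0 (1 : Matrix v v ℝ) * Ξ *
        fromBlocks C 0 0 (1 : Matrix v v ℝ))).IsHermitian := by
    rw [IsHermitian, conjTranspose_eq_transpose_of_trivial]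
    simp [fromBlocks_transpose, hP, hΞ, Matrix.mul_assoc, add_comm]
  have hform : ∀ (x : z → ℝ) (p : v → ℝ), Sum.elim x p ⬝ᵥ
      (-(fromBlocks (Aᵀ * P + P * A) (P * B) (Bᵀ * P) 0 +
      fromBlocks Cᵀ 0 0 (1 : Matrix v v ℝ) * Ξ *
        fromBlocks C 0 0 (1 : Matrix v v ℝ))) *ᵥ Sum.elim x p
      = -(2 * ((P *ᵥ x) ⬝ᵥ (A *ᵥ x + B *ᵥ p)) +
        Sum.elim (C *ᵥ x) p ⬝ᵥ Ξ *ᵥ Sum.elim (C *ᵥ x) p) := fun x p => by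
    have hK : fromBlocks C 0 0 (1 : Matrix v v ℝ) *ᵥ Sum.elim x p = Sum.elim (C *ᵥ x) p := by
      simp [fromBlocks_mulVec]
    have hKt : fromBlocks Cᵀ 0 0 (1 : Matrix v v ℝ) = (fromBlocks C 0 0 (1 : Matrix v v ℝ))ᵀ := by
      simp [fromBlocks_transpose]
    have hmove : ∀ (M : Matrix z z ℝ) (a b : z → ℝ), a ⬝ᵥ Mᵀ *ᵥ b = (M *ᵥ a) ⬝ᵥ b :=
      fun M a b => by rw [dotProduct_mulVec, vecMul_transpose]
    have hP' : ∀ a b : z → ℝ, a ⬝ᵥ P *ᵥ b = (P *ᵥ a) ⬝ᵥ b := fun a b => by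
      conv_lhs => rw [← hP]
      exact hmove P a b
    rw [neg_mulVec, dotProduct_neg, add_mulVec, dotProduct_add, hKt, ← mulVec_mulVec,
      ← mulVec_mulVec, dotProduct_mulVec _ (_)ᵀ, vecMul_transpose, hK]
    congr 2
    simp only [fromBlocks_mulVec, sumElim_dotProduct_sumElim, Sum.elim_comp_inl,
      Sum.elim_comp_inr, add_mulVec, ← mulVec_mulVec, dotProduct_add, zero_mulVec, add_zero,
      hmove, hP']
    rw [dotProduct_mulVec p, vecMul_transpose, dotProduct_comm (P *ᵥ A *ᵥ x),
      hP' x (A *ᵥ x), dotProduct_comm (B *ᵥ p)]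
    ring
  rw [SatisfiesLMI, posSemidef_iff_dotProduct_mulVec]
  constructor
  · rintro ⟨-, h⟩ x p
    have := h (Sum.elim x p)
    rw [star_trivial, hform] at this
    linarith
  · refine fun h => ⟨hsym, fun w => ?_⟩
    obtain ⟨x, p, rfl⟩ : ∃ x p, w = Sum.elim x p :=
      ⟨w ∘ Sum.inl, w ∘ Sum.inr, (Sum.elim_comp_inl_inr w).symm⟩
    rw [star_trivial, hform]
    linarith [h x p]

end Blocks

/-! ### Sector weights -/

section SectorWeights

theorem dotProduct_self_nonneg_real {n : Type*} [Fintype n] (a : n → ℝ) : 0 ≤ a ⬝ᵥ a := by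
  simpa using dotProduct_star_self_nonneg a

/-- A sector term with a suitable weight dominates the cross term `-μ ⟨a, p⟩`. For `L > 0` the weight
`μ / L` cancels it; for `L = 0` a large weight is needed, at the price of a small multiple of
`‖a‖²`. -/
theorem exists_sector_weight (n : Type*) [Fintype n] {L μ η : ℝ} (hL : 0 ≤ L) (hμ : 0 < μ)
    (hη : 0 < η) : ∃ φ c : ℝ, 0 ≤ φ ∧ 0 < c ∧ ∀ a p : n → ℝ,
      -μ * (a ⬝ᵥ p) + φ * (L * (a ⬝ᵥ p) - p ⬝ᵥ p) ≤ η * (a ⬝ᵥ a) - c * (p ⬝ᵥ p) := by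
  have hnn : ∀ a : n → ℝ, 0 ≤ a ⬝ᵥ a := dotProduct_self_nonneg_real
  rcases hL.eq_or_lt with rfl | hL
  · refine ⟨μ ^ 2 / (4 * η) + 1, 1, by positivity, one_pos, fun a p => ?_⟩
    have h := hnn ((2 * η) • a + μ • p)
    simp only [add_dotProduct, dotProduct_add, smul_dotProduct, dotProduct_smul, smul_eq_mul] at h
    rw [dotProduct_comm p a] at h
    have e : η * (a ⬝ᵥ a) + μ * (a ⬝ᵥ p) + μ ^ 2 / (4 * η) * (p ⬝ᵥ p)
        = (4 * η)⁻¹ * (2 * η * (2 * η * a ⬝ᵥ a) + μ * (2 * η * a ⬝ᵥ p) +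
          (2 * η * (μ * a ⬝ᵥ p) + μ * (μ * p ⬝ᵥ p))) := by
      field_simp
      ring
    have h2 : 0 ≤ η * (a ⬝ᵥ a) + μ * (a ⬝ᵥ p) + μ ^ 2 / (4 * η) * (p ⬝ᵥ p) := by
      rw [e]
      refine mul_nonneg (by positivity) ?_
      linarith
    linarith
  · refine ⟨μ / L, μ / L, by positivity, by positivity, fun a p => ?_⟩
    have h := mul_nonneg hη.le (hnn a)
    have e : μ / L * (L * (a ⬝ᵥ p) - p ⬝ᵥ p) = μ * (a ⬝ᵥ p) - μ / L * (p ⬝ᵥ p) := by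
      field_simp
    linarith

/-- Boundedness of a linear map, in terms of dot products. -/
theorem exists_mul_mulVec_sq_le {U Y : Type*} [Fintype U] [Fintype Y] (G : Matrix Y U ℝ) :
    ∃ κ > 0, ∀ u : U → ℝ, κ * ((G *ᵥ u) ⬝ᵥ (G *ᵥ u)) ≤ u ⬝ᵥ u := by
  have h := eventually_forall_add_mul_neg (N := fun u : U → ℝ => -(u ⬝ᵥ u))
    (D := fun u => (G *ᵥ u) ⬝ᵥ (G *ᵥ u)) (by fun_prop) (by fun_prop)
    (fun c v => by simp only [smul_dotProduct, dotProduct_smul, smul_eq_mul]; ring)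
    (fun c v => by
      simp only [mulVec_smul, smul_dotProduct, dotProduct_smul, smul_eq_mul]; ring)
    (fun v => by simpa using dotProduct_star_self_nonneg v)
    (fun v hv h0 => absurd (dotProduct_self_eq_zero.mp (neg_eq_zero.mp h0)) hv)
  obtain ⟨κ, hκ, hκ0⟩ := (h.and self_mem_nhdsWithin).exists
  refine ⟨κ, hκ0, fun u => ?_⟩
  by_cases hu : u = 0
  · simp [hu]
  · linarith [hκ u hu]

end SectorWeights

/-! ### Feasibility of the LMI -/

section ReducedSystem

variable {X U Y₁ Y₂ : Type*} [Fintype X] [Fintype U] [Fintype Y₁] [Fintype Y₂]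

/-- The right-hand side of the `u`-equation, as a linear function of `u` and of the outputs
`(p, q, r)` of the nonlinearity. -/
noncomputable def inputRate (G₁ : Matrix Y₁ U ℝ) (G₂ : Matrix Y₂ U ℝ) (m μ : ℝ)
    (u p : U → ℝ) (q : Y₁ → ℝ) (r : Y₂ → ℝ) : U → ℝ :=
  (-m) • u - p - G₁ᵀ *ᵥ q - μ⁻¹ • (G₂ᵀ *ᵥ r)

/-- The right-hand side of the `l`-equation, as a linear function of `l` and of the output `r` of
the nonlinearity. -/
noncomputable def multRate (Q : Matrix Y₂ Y₂ ℝ) (μ γ : ℝ) (l r : Y₂ → ℝ) : Y₂ → ℝ :=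
  (-μ) • l - γ • (Q *ᵥ l) + r

/-- The supply rate of the multiplier, in terms of the outputs `(y₁, y₂, y₃)` of the linear part. -/
noncomputable def supply (Lhat Lh φ₁ φ₂ : ℝ) (y₁ p : U → ℝ) (y₂ q : Y₁ → ℝ) (y₃ r : Y₂ → ℝ) : ℝ :=
  φ₁ * (Lhat * (y₁ ⬝ᵥ p) - p ⬝ᵥ p) + φ₂ * (Lh * (y₂ ⬝ᵥ q) - q ⬝ᵥ q) + (y₃ ⬝ᵥ r - r ⬝ᵥ r)

/-- The derivative of `μ (‖u‖² + ‖l‖²) / 2` along the reduced system, in which the plant state is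
replaced by its equilibrium `H u`, plus the supply rate; `G₁` and `G₂` are the static gains of the
plant. The argument is `(u, l, p, q, r)`. -/
noncomputable def reducedForm (G₁ : Matrix Y₁ U ℝ) (G₂ : Matrix Y₂ U ℝ) (Q : Matrix Y₂ Y₂ ℝ)
    (m μ γ Lhat Lh φ₁ φ₂ : ℝ)
    (v : (U → ℝ) × (Y₂ → ℝ) × (U → ℝ) × (Y₁ → ℝ) × (Y₂ → ℝ)) : ℝ :=
  μ * (v.1 ⬝ᵥ inputRate G₁ G₂ m μ v.1 v.2.2.1 v.2.2.2.1 v.2.2.2.2)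
    + μ * (v.2.1 ⬝ᵥ multRate Q μ γ v.2.1 v.2.2.2.2)
    + supply Lhat Lh φ₁ φ₂ v.1 v.2.2.1 (G₁ *ᵥ v.1) v.2.2.2.1
        (G₂ *ᵥ v.1 + μ • v.2.1) v.2.2.2.2

/-- The derivative of the cross term `⟨l, G₂ u⟩` along the reduced system. -/
noncomputable def crossForm (G₁ : Matrix Y₁ U ℝ) (G₂ : Matrix Y₂ U ℝ) (Q : Matrix Y₂ Y₂ ℝ) (m μ γ : ℝ)
    (v : (U → ℝ) × (Y₂ → ℝ) × (U → ℝ) × (Y₁ → ℝ) × (Y₂ → ℝ)) : ℝ :=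
  (G₂ᵀ *ᵥ v.2.1) ⬝ᵥ inputRate G₁ G₂ m μ v.1 v.2.2.1 v.2.2.2.1 v.2.2.2.2
    + (G₂ *ᵥ v.1) ⬝ᵥ multRate Q μ γ v.2.1 v.2.2.2.2

/-- The cross terms in `(u, r)` cancel because the storage weight of `u` is `μ`; the weight `μ` of `l`
completes the square in `(l, r)`. -/
theorem reducedForm_eq (G₁ : Matrix Y₁ U ℝ) (G₂ : Matrix Y₂ U ℝ) (Q : Matrix Y₂ Y₂ ℝ)
    {m μ γ Lhat Lh φ₁ φ₂ : ℝ} (hμ : μ ≠ 0) (u p : U → ℝ) (l r : Y₂ → ℝ) (q : Y₁ → ℝ) :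
    reducedForm G₁ G₂ Q m μ γ Lhat Lh φ₁ φ₂ (u, l, p, q, r) =
      -(μ * m) * (u ⬝ᵥ u) + (-μ * (u ⬝ᵥ p) + φ₁ * (Lhat * (u ⬝ᵥ p) - p ⬝ᵥ p))
      + (-μ * ((G₁ *ᵥ u) ⬝ᵥ q) + φ₂ * (Lh * ((G₁ *ᵥ u) ⬝ᵥ q) - q ⬝ᵥ q))
      - (r - μ • l) ⬝ᵥ (r - μ • l) - μ * γ * (l ⬝ᵥ Q *ᵥ l) := by
  simp only [reducedForm, inputRate, multRate, supply, dotProduct_sub, dotProduct_add,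
    dotProduct_smul, sub_dotProduct, add_dotProduct, smul_dotProduct, smul_eq_mul, neg_smul,
    dotProduct_neg, dotProduct_mulVec, vecMul_transpose]
  rw [dotProduct_comm r l]
  field_simp
  ring

/-- For suitable sector weights the reduced form is nonpositive, and it vanishes only where
`u, p, q` vanish, `r = μ l` and `Q l = 0`. -/
theorem exists_weights_reducedForm (G₁ : Matrix Y₁ U ℝ) (G₂ : Matrix Y₂ U ℝ)
    {Q : Matrix Y₂ Y₂ ℝ} (hQ : Q.PosSemidef) {m μ γ Lhat Lh : ℝ} (hm : 0 < m) (hμ : 0 < μ)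
    (hγ : 0 < γ) (hLhat : 0 ≤ Lhat) (hLh : 0 ≤ Lh) :
    ∃ φ₁ φ₂ : ℝ, 0 ≤ φ₁ ∧ 0 ≤ φ₂ ∧ ∀ (u p : U → ℝ) (l r : Y₂ → ℝ) (q : Y₁ → ℝ),
      reducedForm G₁ G₂ Q m μ γ Lhat Lh φ₁ φ₂ (u, l, p, q, r) ≤ 0 ∧
      (reducedForm G₁ G₂ Q m μ γ Lhat Lh φ₁ φ₂ (u, l, p, q, r) = 0 →
        u = 0 ∧ p = 0 ∧ q = 0 ∧ r = μ • l ∧ Q *ᵥ l = 0) := by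
  have hη : 0 < μ * m / 3 := by positivity
  obtain ⟨κ, hκ, hG⟩ := exists_mul_mulVec_sq_le G₁
  obtain ⟨φ₁, c₁, hφ₁, hc₁, h₁⟩ := exists_sector_weight U hLhat hμ hη
  obtain ⟨φ₂, c₂, hφ₂, hc₂, h₂⟩ := exists_sector_weight Y₁ hLh hμ (mul_pos hη hκ)
  refine ⟨φ₁, φ₂, hφ₁, hφ₂, fun u p l r q => ?_⟩
  rw [reducedForm_eq G₁ G₂ Q hμ.ne']
  have a1 := h₁ u p
  have a2 := h₂ (G₁ *ᵥ u) q
  have a3 := mul_le_mul_of_nonneg_left (hG u) hη.le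
  have b1 : 0 ≤ μ * m / 3 * (u ⬝ᵥ u) := mul_nonneg hη.le (dotProduct_self_nonneg_real u)
  have b2 : 0 ≤ c₁ * (p ⬝ᵥ p) := mul_nonneg hc₁.le (dotProduct_self_nonneg_real p)
  have b3 : 0 ≤ c₂ * (q ⬝ᵥ q) := mul_nonneg hc₂.le (dotProduct_self_nonneg_real q)
  have b4 := dotProduct_self_nonneg_real (r - μ • l)
  have hQl : 0 ≤ l ⬝ᵥ Q *ᵥ l := by simpa using hQ.dotProduct_mulVec_nonneg l
  have hμγ : 0 < μ * γ := mul_pos hμ hγ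
  have b5 : 0 ≤ μ * γ * (l ⬝ᵥ Q *ᵥ l) := mul_nonneg hμγ.le hQl
  refine ⟨by linarith, fun h0 => ⟨?_, ?_, ?_, ?_, ?_⟩⟩
  · exact dotProduct_self_eq_zero.mp
      ((mul_eq_zero.mp (by linarith : μ * m / 3 * (u ⬝ᵥ u) = 0)).resolve_left hη.ne')
  · exact dotProduct_self_eq_zero.mp
      ((mul_eq_zero.mp (by linarith : c₁ * (p ⬝ᵥ p) = 0)).resolve_left hc₁.ne')
  · exact dotProduct_self_eq_zero.mp
      ((mul_eq_zero.mp (by linarith : c₂ * (q ⬝ᵥ q) = 0)).resolve_left hc₂.ne')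
  · exact sub_eq_zero.mp (dotProduct_self_eq_zero.mp (by linarith))
  · refine (hQ.dotProduct_mulVec_zero_iff l).mp ?_
    simpa using
      (mul_eq_zero.mp (by linarith : μ * γ * (l ⬝ᵥ Q *ᵥ l) = 0)).resolve_left hμγ.ne'

/-- On the kernel of the reduced form the cross term decays at the rate `‖G₂ᵀ l‖²`, so by the
null space condition it is negative there. -/
theorem eventually_reducedForm_add_crossForm_neg (G₁ : Matrix Y₁ U ℝ) (G₂ : Matrix Y₂ U ℝ)
    {Q : Matrix Y₂ Y₂ ℝ}
    (hnull : ∀ l : Y₂ → ℝ, G₂ᵀ *ᵥ l = 0 → Q *ᵥ l = 0 → l = 0) {m μ γ Lhat Lh φ₁ φ₂ : ℝ}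
    (hμ : 0 < μ)
    (h : ∀ (u p : U → ℝ) (l r : Y₂ → ℝ) (q : Y₁ → ℝ),
      reducedForm G₁ G₂ Q m μ γ Lhat Lh φ₁ φ₂ (u, l, p, q, r) ≤ 0 ∧
      (reducedForm G₁ G₂ Q m μ γ Lhat Lh φ₁ φ₂ (u, l, p, q, r) = 0 →
        u = 0 ∧ p = 0 ∧ q = 0 ∧ r = μ • l ∧ Q *ᵥ l = 0)) :
    ∀ᶠ δ in 𝓝[>] (0 : ℝ), ∀ v, v ≠ 0 → reducedForm G₁ G₂ Q m μ γ Lhat Lh φ₁ φ₂ v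
      + δ * crossForm G₁ G₂ Q m μ γ v < 0 := by
  refine eventually_forall_add_mul_neg ?_ ?_ ?_ ?_ (fun ⟨u, l, p, q, r⟩ => (h u p l r q).1) ?_
  · unfold reducedForm inputRate multRate supply; fun_prop
  · unfold crossForm inputRate multRate; fun_prop
  · intro c v
    simp only [reducedForm, inputRate, multRate, supply, dotProduct_sub, dotProduct_add,
      dotProduct_smul, add_dotProduct, smul_dotProduct, smul_eq_mul, Prod.smul_fst,
      Prod.smul_snd, mulVec_smul]
    ring
  · intro c v
    simp only [crossForm, inputRate, multRate, dotProduct_sub, dotProduct_add,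
      dotProduct_smul, smul_dotProduct, smul_eq_mul, Prod.smul_fst,
      Prod.smul_snd, mulVec_smul]
    ring
  · rintro ⟨u, l, p, q, r⟩ hv h0
    obtain ⟨rfl, rfl, rfl, rfl, hQl⟩ := (h u p l r q).2 h0
    have e : crossForm G₁ G₂ Q m μ γ ((0 : U → ℝ), l, (0 : U → ℝ), (0 : Y₁ → ℝ), μ • l)
        = -((G₂ᵀ *ᵥ l) ⬝ᵥ (G₂ᵀ *ᵥ l)) := by
      simp [crossForm, inputRate, multRate, mulVec_smul, inv_smul_smul₀ hμ.ne']
    rw [e, neg_neg_iff_pos]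
    refine lt_of_le_of_ne (dotProduct_self_nonneg_real _) fun h1 => hv ?_
    have hl := hnull l (dotProduct_self_eq_zero.mp h1.symm) hQl
    simp [hl]

/-- The storage function in the coordinates `(ξ, u, l)`, where `ξ` is the deviation of the plant
state from its equilibrium under the input `u`. -/
noncomputable def storage (R : Matrix X X ℝ) (G₂ : Matrix Y₂ U ℝ) (μ δ : ℝ)
    (ξ : X → ℝ) (u : U → ℝ) (l : Y₂ → ℝ) : ℝ :=
  ξ ⬝ᵥ R *ᵥ ξ + μ * (u ⬝ᵥ u) + μ * (l ⬝ᵥ l) + 2 * δ * (l ⬝ᵥ G₂ *ᵥ u)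

theorem eventually_storage_pos {R : Matrix X X ℝ} (hR : R.PosDef) (G₂ : Matrix Y₂ U ℝ) {μ : ℝ}
    (hμ : 0 < μ) : ∀ᶠ δ in 𝓝[>] (0 : ℝ), ∀ v : (X → ℝ) × (U → ℝ) × (Y₂ → ℝ), v ≠ 0 →
      0 < storage R G₂ μ δ v.1 v.2.1 v.2.2 := by
  have hR0 : ∀ ξ : X → ℝ, 0 ≤ ξ ⬝ᵥ R *ᵥ ξ := fun ξ => by
    simpa using hR.posSemidef.dotProduct_mulVec_nonneg ξ
  have h := eventually_forall_add_mul_neg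
    (N := fun v : (X → ℝ) × (U → ℝ) × (Y₂ → ℝ) => -storage R G₂ μ 0 v.1 v.2.1 v.2.2)
    (D := fun v => -(2 * (v.2.2 ⬝ᵥ G₂ *ᵥ v.2.1)))
    (by unfold storage; fun_prop) (by fun_prop)
    (fun c v => by
      simp only [storage, mulVec_smul, smul_dotProduct, dotProduct_smul, smul_eq_mul,
        Prod.smul_fst, Prod.smul_snd]
      ring)
    (fun c v => by
      simp only [mulVec_smul, smul_dotProduct, dotProduct_smul, smul_eq_mul,
        Prod.smul_fst, Prod.smul_snd]
      ring)
    (fun v => by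
      have h1 := hR0 v.1
      have h2 := mul_nonneg hμ.le (dotProduct_self_nonneg_real v.2.1)
      have h3 := mul_nonneg hμ.le (dotProduct_self_nonneg_real v.2.2)
      simp only [storage]
      linarith)
    (fun v hv h0 => by
      have h1 := hR0 v.1
      have h2 := mul_nonneg hμ.le (dotProduct_self_nonneg_real v.2.1)
      have h3 := mul_nonneg hμ.le (dotProduct_self_nonneg_real v.2.2)
      simp only [storage] at h0
      refine absurd ?_ hv
      refine Prod.ext ?_ (Prod.ext ?_ ?_)
      · by_contra hne
        have := hR.dotProduct_mulVec_pos hne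
        rw [star_trivial] at this
        linarith
      · exact dotProduct_self_eq_zero.mp
          ((mul_eq_zero.mp (by linarith : μ * (v.2.1 ⬝ᵥ v.2.1) = 0)).resolve_left hμ.ne')
      · exact dotProduct_self_eq_zero.mp
          ((mul_eq_zero.mp (by linarith : μ * (v.2.2 ⬝ᵥ v.2.2) = 0)).resolve_left hμ.ne'))
  filter_upwards [h] with δ hδ v hv
  have := hδ v hv
  simp only [storage] at this ⊢
  linarith

/-- The dissipation of the closed loop in the coordinates `(ξ, u, l)`, without the fast part
`ε⁻¹ ⟨R ξ, A ξ⟩`; here `x = ξ + H u`. -/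
noncomputable def slowForm (R : Matrix X X ℝ) (H : Matrix X U ℝ) (C₁ : Matrix Y₁ X ℝ) (C₂ : Matrix Y₂ X ℝ)
    (Q : Matrix Y₂ Y₂ ℝ) (m μ γ Lhat Lh φ₁ φ₂ δ : ℝ)
    (v : (X → ℝ) × (U → ℝ) × (Y₂ → ℝ) × (U → ℝ) × (Y₁ → ℝ) × (Y₂ → ℝ)) : ℝ :=
  (μ • v.2.1 + δ • ((C₂ * H)ᵀ *ᵥ v.2.2.1) - Hᵀ *ᵥ (R *ᵥ v.1)) ⬝ᵥ
      inputRate (C₁ * H) (C₂ * H) m μ v.2.1 v.2.2.2.1 v.2.2.2.2.1 v.2.2.2.2.2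
    + (δ • ((C₂ * H) *ᵥ v.2.1) + μ • v.2.2.1) ⬝ᵥ multRate Q μ γ v.2.2.1 v.2.2.2.2.2
    + supply Lhat Lh φ₁ φ₂ v.2.1 v.2.2.2.1 (C₁ *ᵥ v.1 + (C₁ * H) *ᵥ v.2.1) v.2.2.2.2.1
        (C₂ *ᵥ v.1 + (C₂ * H) *ᵥ v.2.1 + μ • v.2.2.1) v.2.2.2.2.2

/-- Dissipativity of the closed loop in the coordinates `(ξ, u, l)`: a small weight `δ` of the cross
term makes the reduced form strict, a small `ε` lets the fast part absorb all terms that contain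
`ξ`, and a small rate `ρ` is left over. -/
theorem exists_dissipation {A R : Matrix X X ℝ} (hR : R.PosDef)
    (hAR : (-(Aᵀ * R + R * A)).PosDef) (H : Matrix X U ℝ) (C₁ : Matrix Y₁ X ℝ)
    (C₂ : Matrix Y₂ X ℝ) {Q : Matrix Y₂ Y₂ ℝ} (hQ : Q.PosSemidef)
    (hnull : ∀ l : Y₂ → ℝ, (C₂ * H)ᵀ *ᵥ l = 0 → Q *ᵥ l = 0 → l = 0)
    {m μ γ Lhat Lh : ℝ} (hm : 0 < m) (hμ : 0 < μ)
    (hγ : 0 < γ) (hLhat : 0 ≤ Lhat) (hLh : 0 ≤ Lh) :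
    ∃ ε ρ φ₁ φ₂ δ : ℝ, 0 < ε ∧ 0 < ρ ∧ 0 ≤ φ₁ ∧ 0 ≤ φ₂ ∧
      (∀ v : (X → ℝ) × (U → ℝ) × (Y₂ → ℝ), v ≠ 0 →
        0 < storage R (C₂ * H) μ δ v.1 v.2.1 v.2.2) ∧
      ∀ v : (X → ℝ) × (U → ℝ) × (Y₂ → ℝ) × (U → ℝ) × (Y₁ → ℝ) × (Y₂ → ℝ),
        ε⁻¹ * ((R *ᵥ v.1) ⬝ᵥ (A *ᵥ v.1)) + slowForm R H C₁ C₂ Q m μ γ Lhat Lh φ₁ φ₂ δ v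
          + ρ * storage R (C₂ * H) μ δ v.1 v.2.1 v.2.2.1 ≤ 0 := by
  obtain ⟨φ₁, φ₂, hφ₁, hφ₂, hφ⟩ :=
    exists_weights_reducedForm (C₁ * H) (C₂ * H) hQ hm hμ hγ hLhat hLh
  obtain ⟨δ, hδ1, hδ2⟩ := ((eventually_reducedForm_add_crossForm_neg (C₁ * H) (C₂ * H) hnull hμ
    hφ).and (eventually_storage_pos hR (C₂ * H) hμ)).exists
  have hfast : ∀ ξ : X → ℝ, ξ ⬝ᵥ (-(Aᵀ * R + R * A)) *ᵥ ξ = -2 * ((R *ᵥ ξ) ⬝ᵥ (A *ᵥ ξ)) :=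
    fun ξ => by
      have hRt : Rᵀ = R := by
        simpa [conjTranspose_eq_transpose_of_trivial] using hR.isHermitian.eq
      rw [neg_mulVec, dotProduct_neg, add_mulVec, dotProduct_add, ← mulVec_mulVec,
        ← mulVec_mulVec, dotProduct_mulVec, vecMul_transpose, dotProduct_mulVec ξ R,
        ← mulVec_transpose, hRt, dotProduct_comm (A *ᵥ ξ)]
      ring
  have hcont : Continuous (slowForm R H C₁ C₂ Q m μ γ Lhat Lh φ₁ φ₂ δ) := by
    unfold slowForm inputRate multRate supply; fun_prop
  have hhom : ∀ (c : ℝ) v, slowForm R H C₁ C₂ Q m μ γ Lhat Lh φ₁ φ₂ δ (c • v)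
      = c ^ 2 * slowForm R H C₁ C₂ Q m μ γ Lhat Lh φ₁ φ₂ δ v := fun c v => by
    simp only [slowForm, inputRate, multRate, supply, dotProduct_sub, dotProduct_add,
      dotProduct_smul, sub_dotProduct, add_dotProduct, smul_dotProduct, smul_eq_mul, Prod.smul_fst,
      Prod.smul_snd, mulVec_smul]
    ring
  have hslow : ∀ v, slowForm R H C₁ C₂ Q m μ γ Lhat Lh φ₁ φ₂ δ ((0 : X → ℝ), v)
      = reducedForm (C₁ * H) (C₂ * H) Q m μ γ Lhat Lh φ₁ φ₂ v
        + δ * crossForm (C₁ * H) (C₂ * H) Q m μ γ v := fun v => by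
    simp only [slowForm, reducedForm, crossForm, mulVec_zero, sub_zero, zero_add, add_dotProduct,
      smul_dotProduct, smul_eq_mul]
    ring
  obtain ⟨ε, hε, hε0⟩ := ((eventually_forall_add_mul_neg
    (N := fun v : (X → ℝ) × (U → ℝ) × (Y₂ → ℝ) × (U → ℝ) × (Y₁ → ℝ) × (Y₂ → ℝ) =>
      (R *ᵥ v.1) ⬝ᵥ (A *ᵥ v.1))
    (by fun_prop) hcont
    (fun c v => by
      simp only [mulVec_smul, smul_dotProduct, dotProduct_smul, smul_eq_mul, Prod.smul_fst]
      ring) hhom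
    (fun v => by
      have := hAR.posSemidef.dotProduct_mulVec_nonneg v.1
      rw [star_trivial, hfast] at this
      linarith)
    (by
      rintro ⟨ξ, v⟩ hv h0
      have hξ : ξ = 0 := by
        by_contra hne
        have := hAR.dotProduct_mulVec_pos hne
        rw [star_trivial, hfast] at this
        simp only at h0
        linarith
      subst hξ
      rw [hslow]
      exact hδ1 v fun h => hv (by rw [h]; rfl))).and self_mem_nhdsWithin).exists
  have hε0 : 0 < ε := hε0
  have hneg : ∀ v, v ≠ 0 → ε⁻¹ * ((R *ᵥ v.1) ⬝ᵥ (A *ᵥ v.1))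
      + slowForm R H C₁ C₂ Q m μ γ Lhat Lh φ₁ φ₂ δ v < 0 := fun v hv => by
    have h1 := mul_neg_of_pos_of_neg (inv_pos.mpr hε0) (hε v hv)
    rwa [mul_add, inv_mul_cancel_left₀ hε0.ne'] at h1
  have h0 : ∀ v, ε⁻¹ * ((R *ᵥ v.1) ⬝ᵥ (A *ᵥ v.1))
      + slowForm R H C₁ C₂ Q m μ γ Lhat Lh φ₁ φ₂ δ v ≤ 0 := fun v => by
    by_cases hv : v = 0
    · have := hhom 0 0
      rw [zero_smul, zero_pow two_ne_zero, zero_mul] at this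
      rw [hv, this]
      simp
    · exact (hneg v hv).le
  obtain ⟨ρ, hρ, hρ0⟩ := ((eventually_forall_add_mul_neg
    (N := fun v => ε⁻¹ * ((R *ᵥ v.1) ⬝ᵥ (A *ᵥ v.1))
      + slowForm R H C₁ C₂ Q m μ γ Lhat Lh φ₁ φ₂ δ v)
    (D := fun v => storage R (C₂ * H) μ δ v.1 v.2.1 v.2.2.1)
    (by fun_prop) (by unfold storage; fun_prop)
    (fun c v => by
      rw [hhom]
      simp only [mulVec_smul, smul_dotProduct, dotProduct_smul, smul_eq_mul, Prod.smul_fst]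
      ring)
    (fun c v => by
      simp only [storage, mulVec_smul, smul_dotProduct, dotProduct_smul, smul_eq_mul,
        Prod.smul_fst, Prod.smul_snd]
      ring)
    h0 (fun v hv hz => absurd hz (hneg v hv).ne)).and self_mem_nhdsWithin).exists
  refine ⟨ε, ρ, φ₁, φ₂, δ, hε0, hρ0, hφ₁, hφ₂, hδ2, fun v => ?_⟩
  by_cases hv : v = 0
  · subst hv
    have := h0 0
    simpa [storage] using this
  · exact (hρ v hv).le

end ReducedSystem

section LMI

variable {X U Y₁ Y₂ W : Type*} [Fintype X] [DecidableEq U] [DecidableEq Y₂]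

/-- The matrix of the storage function in the coordinates `(x, u, l)`, with `ξ = x - H u`. -/
noncomputable def storageMatrix (R : Matrix X X ℝ) (H : Matrix X U ℝ) (G₂ : Matrix Y₂ U ℝ) (μ δ : ℝ) :
    Matrix (X ⊕ (U ⊕ Y₂)) (X ⊕ (U ⊕ Y₂)) ℝ :=
  blocks3 R (-(R * H)) 0
    (-(R * H)ᵀ) (μ • 1 + Hᵀ * R * H) (δ • G₂ᵀ)
    0 (δ • G₂) (μ • 1)

theorem storageMatrix_transpose {R : Matrix X X ℝ} (hR : Rᵀ = R) (H : Matrix X U ℝ)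
    (G₂ : Matrix Y₂ U ℝ) (μ δ : ℝ) :
    (storageMatrix R H G₂ μ δ)ᵀ = storageMatrix R H G₂ μ δ := by
  simp [storageMatrix, blocks3_transpose, hR, Matrix.mul_assoc]

theorem storageMatrix_mulVec [Fintype U] [Fintype Y₂] {R : Matrix X X ℝ} (hR : Rᵀ = R) (H : Matrix X U ℝ)
    (G₂ : Matrix Y₂ U ℝ) (μ δ : ℝ) (ξ : X → ℝ) (u : U → ℝ) (l : Y₂ → ℝ) :
    storageMatrix R H G₂ μ δ *ᵥ Sum.elim (ξ + H *ᵥ u) (Sum.elim u l) =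
      Sum.elim (R *ᵥ ξ) (Sum.elim (μ • u + δ • (G₂ᵀ *ᵥ l) - Hᵀ *ᵥ (R *ᵥ ξ))
        (δ • (G₂ *ᵥ u) + μ • l)) := by
  rw [storageMatrix, blocks3_mulVec]
  congr 1
  · simp [mulVec_add, neg_mulVec]
  congr 1
  · simp only [mulVec_add, neg_mulVec, add_mulVec, transpose_mul, hR, smul_mulVec, one_mulVec,
      ← mulVec_mulVec]
    abel
  · simp [smul_mulVec]

theorem dotProduct_storageMatrix_mulVec [Fintype U] [Fintype Y₂] {R : Matrix X X ℝ} (hR : Rᵀ = R) (H : Matrix X U ℝ)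
    (G₂ : Matrix Y₂ U ℝ) (μ δ : ℝ) (ξ : X → ℝ) (u : U → ℝ) (l : Y₂ → ℝ) :
    (storageMatrix R H G₂ μ δ *ᵥ Sum.elim (ξ + H *ᵥ u) (Sum.elim u l)) ⬝ᵥ
      Sum.elim (ξ + H *ᵥ u) (Sum.elim u l) = storage R G₂ μ δ ξ u l := by
  rw [storageMatrix_mulVec hR]
  simp only [sumElim_dotProduct_sumElim, dotProduct_add, add_dotProduct, sub_dotProduct,
    smul_dotProduct, smul_eq_mul, storage]
  rw [dotProduct_comm (G₂ᵀ *ᵥ l), dotProduct_comm (Hᵀ *ᵥ R *ᵥ ξ), dotProduct_mulVec u G₂ᵀ,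
    dotProduct_mulVec u Hᵀ, vecMul_transpose, vecMul_transpose, dotProduct_comm _ ξ,
    dotProduct_comm (G₂ *ᵥ u) l, dotProduct_comm (H *ᵥ u)]
  ring

theorem exists_satisfiesLMI [DecidableEq X] [Fintype U] [Fintype Y₁] [DecidableEq Y₁]
    [Fintype Y₂] (S : Plant X U Y₁ Y₂ W) (hA : IsHurwitz S.A)
    {Q : Matrix Y₂ Y₂ ℝ} (hQ : Q.PosSemidef)
    (hnull : LinearMap.ker (S.Pi₂u * S.Pi₂uᵀ).mulVecLin ⊓ LinearMap.ker Q.mulVecLin = ⊥)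
    {m Lhat Lh μ γ : ℝ} (hm : 0 < m) (hLhat : 0 ≤ Lhat) (hLh : 0 ≤ Lh) (hμ : 0 < μ)
    (hγ : 0 < γ) :
    ∃ ε ρ φ₁ φ₂ : ℝ, 0 < ε ∧ 0 < ρ ∧ 0 ≤ φ₁ ∧ 0 ≤ φ₂ ∧
    ∃ P : Matrix (X ⊕ (U ⊕ Y₂)) (X ⊕ (U ⊕ Y₂)) ℝ, P.PosDef ∧
      SatisfiesLMI (S.matA Q m μ γ ε + ρ • 1) (S.matB μ) (S.matC μ) P
        (multiplier U Y₁ Y₂ Lhat Lh φ₁ φ₂) := by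
  obtain ⟨R, hR, hAR⟩ := hA.exists_posDef_lyapunov
  have hRt : Rᵀ = R := by
    simpa [conjTranspose_eq_transpose_of_trivial] using hR.isHermitian.eq
  set H : Matrix X U ℝ := (-S.A)⁻¹ * S.B with hH
  have hG₁ : S.Pi₁u = S.C₁ * H := by rw [Plant.Pi₁u, hH, Matrix.mul_assoc]
  have hG₂ : S.Pi₂u = S.C₂ * H := by rw [Plant.Pi₂u, hH, Matrix.mul_assoc]
  have hAu : IsUnit S.A := by
    apply isUnit_of_isUnit_map_ofReal
    by_contra h
    have h0 : (0 : ℂ) ∈ spectrum ℂ (S.A.map (fun r : ℝ => (r : ℂ))) :=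
      spectrum.zero_mem ℂ h
    simpa using hA 0 h0
  have hAH : S.A * H = -S.B := by
    have h1 : (-S.A) * ((-S.A)⁻¹ * S.B) = S.B :=
      mul_nonsing_inv_cancel_left _ _ ((isUnit_iff_isUnit_det _).mp hAu.neg)
    rw [Matrix.neg_mul] at h1
    rw [hH, ← h1, neg_neg, h1]
  have hnull' : ∀ l : Y₂ → ℝ, (S.C₂ * H)ᵀ *ᵥ l = 0 → Q *ᵥ l = 0 → l = 0 := fun l h1 h2 => by
    have : l ∈ LinearMap.ker (S.Pi₂u * S.Pi₂uᵀ).mulVecLin ⊓ LinearMap.ker Q.mulVecLin := by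
      rw [Submodule.mem_inf, LinearMap.mem_ker, LinearMap.mem_ker, mulVecLin_apply,
        mulVecLin_apply, hG₂, ← mulVec_mulVec, h1, mulVec_zero]
      exact ⟨rfl, h2⟩
    rwa [hnull, Submodule.mem_bot] at this
  obtain ⟨ε, ρ, φ₁, φ₂, δ, hε, hρ, hφ₁, hφ₂, hpos, hdis⟩ :=
    exists_dissipation hR hAR H S.C₁ S.C₂ hQ hnull' hm hμ hγ hLhat hLh
  have hPt := storageMatrix_transpose hRt H (S.C₂ * H) μ δ
  refine ⟨ε, ρ, φ₁, φ₂, hε, hρ, hφ₁, hφ₂, storageMatrix R H (S.C₂ * H) μ δ, ?_, ?_⟩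
  · refine PosDef.of_dotProduct_mulVec_pos
      (by rw [IsHermitian, conjTranspose_eq_transpose_of_trivial, hPt]) fun z hz => ?_
    obtain ⟨x, u, l, rfl⟩ := exists_eq_sumElim_sumElim z
    obtain ⟨ξ, rfl⟩ : ∃ ξ, x = ξ + H *ᵥ u := ⟨x - H *ᵥ u, (sub_add_cancel _ _).symm⟩
    rw [star_trivial, dotProduct_comm, dotProduct_storageMatrix_mulVec hRt]
    refine hpos (ξ, u, l) fun h0 => hz ?_
    simp only [Prod.mk_eq_zero] at h0
    obtain ⟨rfl, rfl, rfl⟩ := h0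
    simp
  · rw [satisfiesLMI_iff hPt (multiplier_transpose U Y₁ Y₂ Lhat Lh φ₁ φ₂)]
    intro z p
    obtain ⟨x, u, l, rfl⟩ := exists_eq_sumElim_sumElim z
    obtain ⟨p, q, r, rfl⟩ := exists_eq_sumElim_sumElim p
    obtain ⟨ξ, rfl⟩ : ∃ ξ, x = ξ + H *ᵥ u := ⟨x - H *ᵥ u, (sub_add_cancel _ _).symm⟩
    have hC : S.matC μ *ᵥ Sum.elim (ξ + H *ᵥ u) (Sum.elim u l) =
        Sum.elim u (Sum.elim (S.C₁ *ᵥ ξ + (S.C₁ * H) *ᵥ u)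
          (S.C₂ *ᵥ ξ + (S.C₂ * H) *ᵥ u + μ • l)) := by
      simp [Plant.matC, blocks3_mulVec, mulVec_add, smul_mulVec]
    have hAB : S.matA Q m μ γ ε *ᵥ Sum.elim (ξ + H *ᵥ u) (Sum.elim u l) +
        S.matB μ *ᵥ Sum.elim p (Sum.elim q r) =
        Sum.elim (ε⁻¹ • (S.A *ᵥ ξ)) (Sum.elim (inputRate (S.C₁ * H) (S.C₂ * H) m μ u p q r)
          (multRate Q μ γ l r)) := by
      rw [Plant.matA, Plant.matB, blocks3_mulVec, blocks3_mulVec, ← Sum.elim_add_add,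
        ← Sum.elim_add_add]
      congr 1
      · have : S.A *ᵥ (H *ᵥ u) = -(S.B *ᵥ u) := by rw [mulVec_mulVec, hAH, neg_mulVec]
        rw [smul_mulVec, smul_mulVec, mulVec_add, this]
        simp
      congr 1
      · simp only [inputRate, smul_mulVec, one_mulVec, neg_mulVec, zero_mulVec, zero_add,
          add_zero, hG₁, hG₂]
        abel
      · simp only [multRate, smul_mulVec, one_mulVec, sub_mulVec, zero_mulVec, zero_add]
    have hd := hdis (ξ, u, l, p, q, r)
    rw [hC, dotProduct_multiplier_mulVec, add_mulVec, add_right_comm, hAB, smul_mulVec,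
      one_mulVec, dotProduct_add, dotProduct_smul, dotProduct_storageMatrix_mulVec hRt,
      storageMatrix_mulVec hRt, sumElim_dotProduct_sumElim, sumElim_dotProduct_sumElim,
      dotProduct_smul, smul_eq_mul, smul_eq_mul]
    simp only [slowForm, supply] at hd
    linarith

end LMI

/-! ### Tracking -/

section Tracking

open scoped MatrixOrder in
/-- A curve whose velocity `v` is dissipative, relative to a moving target `zs` with velocity `zs'`,
for the quadratic form of `P`: in the norm `‖B ·‖` with `P = Bᵀ B` this is the comparison lemma. -/
theorem norm_sub_le_of_dissipation {n : Type*} [Fintype n] [DecidableEq n] {P : Matrix n n ℝ}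
    (hP : P.PosDef) {ρ : ℝ} {z v zs zs' : ℝ → EuclideanSpace ℝ n} (hz : IsIntegralOf z v)
    (hzs : IsIntegralOf zs zs')
    (h : ∀ t, 0 ≤ t → (P *ᵥ (z t - zs t).ofLp) ⬝ᵥ (v t).ofLp ≤
      -ρ * ((P *ᵥ (z t - zs t).ofLp) ⬝ᵥ (z t - zs t).ofLp)) (t : ℝ) (ht : 0 ≤ t) :
    ‖z t - zs t‖ ≤
      √(condNumber P) * ‖z 0 - zs 0‖ * Real.exp (-ρ * t) +
      √(condNumber P) * ∫ τ in (0 : ℝ)..t, Real.exp (-ρ * (t - τ)) * ‖zs' τ‖ := by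
  obtain ⟨B, hB⟩ := CStarAlgebra.nonneg_iff_eq_star_mul_self.mp hP.posSemidef.nonneg
  have hBdet : IsUnit B.det := by
    have h1 := (isUnit_iff_isUnit_det _).mp hP.isUnit
    rw [hB, det_mul] at h1
    exact isUnit_of_mul_isUnit_right h1
  set T := toEuclideanCLM (n := n) (𝕜 := ℝ) B with hT
  set T' := toEuclideanCLM (n := n) (𝕜 := ℝ) B⁻¹ with hT'
  have hTT' : ∀ x, T' (T x) = x := fun x => by
    have : T' * T = 1 := by rw [hT, hT', ← map_mul, nonsing_inv_mul _ hBdet, map_one]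
    exact congrArg (fun F : EuclideanSpace ℝ n →L[ℝ] EuclideanSpace ℝ n => F x) this
  have hnT : ‖toEuclideanCLM (n := n) (𝕜 := ℝ) P‖ = ‖T‖ * ‖T‖ := by
    rw [hB, map_mul, map_star]
    exact T.norm_adjoint_comp_self
  have hnT' : ‖toEuclideanCLM (n := n) (𝕜 := ℝ) P⁻¹‖ = ‖T'‖ * ‖T'‖ := by
    have e : P⁻¹ = B⁻¹ * star B⁻¹ := by
      rw [hB, Matrix.mul_inv_rev, star_eq_conjTranspose, star_eq_conjTranspose,
        conjTranspose_nonsing_inv]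
    rw [e, map_mul, map_star]
    exact CStarRing.norm_self_mul_star (x := T')
  have hcond : √(condNumber P) = ‖T'‖ * ‖T‖ := by
    rw [condNumber, hnT, hnT', show ‖T‖ * ‖T‖ * (‖T'‖ * ‖T'‖) = (‖T'‖ * ‖T‖) ^ 2 by ring,
      Real.sqrt_sq (by positivity)]
  have hform : ∀ x y : EuclideanSpace ℝ n, (P *ᵥ x.ofLp) ⬝ᵥ y.ofLp = ⟪T x, T y⟫ := fun x y => by
    rw [dotProduct_comm, ← inner_toEuclideanCLM, hB, map_mul, map_star,
      mul_apply_eq_comp, ContinuousLinearMap.star_eq_adjoint,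
      ContinuousLinearMap.adjoint_inner_right, real_inner_comm]
  have hv := (hz t ht).1
  have hs := (hzs t ht).1
  have key := norm_le_of_inner_deriv_le (y := fun τ => T (z τ - zs τ))
    (a := fun τ => T (v τ - zs' τ)) (b := fun τ => ‖T‖ * ‖zs' τ‖) (ρ := ρ) ht
    ⟨T.integrable_comp (hv.sub hs).1, T.integrable_comp (hv.sub hs).2⟩ (fun τ hτ => ?_) (hs.norm.const_mul _)
    (fun τ _ => by positivity) (fun τ hτ => ?_)
  · have h1 : ‖z t - zs t‖ ≤ ‖T'‖ * ‖T (z t - zs t)‖ := by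
      conv_lhs => rw [← hTT' (z t - zs t)]
      exact T'.le_opNorm _
    have h2 : ∫ τ in (0 : ℝ)..t, Real.exp (-ρ * (t - τ)) * (‖T‖ * ‖zs' τ‖)
        = ‖T‖ * ∫ τ in (0 : ℝ)..t, Real.exp (-ρ * (t - τ)) * ‖zs' τ‖ := by
      rw [← intervalIntegral.integral_const_mul]
      congr 1; ext τ; ring
    rw [h2] at key
    have h3 : ‖T (z 0 - zs 0)‖ * Real.exp (-ρ * t) ≤ ‖T‖ * ‖z 0 - zs 0‖ * Real.exp (-ρ * t) := by
      gcongr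
      exact T.le_opNorm _
    calc ‖z t - zs t‖ ≤ ‖T'‖ * ‖T (z t - zs t)‖ := h1
      _ ≤ ‖T'‖ * (‖T‖ * ‖z 0 - zs 0‖ * Real.exp (-ρ * t) +
          ‖T‖ * ∫ τ in (0 : ℝ)..t, Real.exp (-ρ * (t - τ)) * ‖zs' τ‖) := by
        gcongr
        exact key.trans (by linarith)
      _ = _ := by rw [hcond]; ring
  · have hv' := (hz τ hτ.1).1
    have hs' := (hzs τ hτ.1).1
    rw [T.intervalIntegral_comp_comm (hv'.sub hs'), intervalIntegral.integral_sub hv' hs',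
      ← map_add, (hz τ hτ.1).2, (hzs τ hτ.1).2]
    congr 1
    abel
  · have h1 := h τ hτ.1
    rw [hform, hform, real_inner_self_eq_norm_sq] at h1
    have h2 := neg_le_of_abs_le (abs_real_inner_le_norm (T (z τ - zs τ)) (T (zs' τ)))
    have h3 := mul_le_mul_of_nonneg_left (T.le_opNorm (zs' τ)) (norm_nonneg (T (z τ - zs τ)))
    rw [map_sub T (v τ), inner_sub_right]
    linarith

theorem ofLp_eq_sumElim_parts {X U Y₂ : Type*} (z : EuclideanSpace ℝ (X ⊕ (U ⊕ Y₂))) :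
    z.ofLp = Sum.elim (xPart z).ofLp (Sum.elim (uPart z).ofLp (lPart z).ofLp) := by
  ext (i | i | i) <;> rfl

variable {X U Y₁ Y₂ W : Type*} [Fintype X] [DecidableEq X] [Fintype U] [DecidableEq U]
  [Fintype Y₁] [DecidableEq Y₁] [Fintype Y₂] [DecidableEq Y₂] [Fintype W] [DecidableEq W]

/-- The output `y₁ = C₁ x + D₁w w`. -/
noncomputable def output₁ (S : Plant X U Y₁ Y₂ W) (w : EuclideanSpace ℝ W)
    (z : EuclideanSpace ℝ (X ⊕ (U ⊕ Y₂))) : EuclideanSpace ℝ Y₁ :=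
  toEuclideanLin S.C₁ (xPart z) + toEuclideanLin S.D₁w w

/-- The argument `y₂ + μ l` of the gradient of the Moreau envelope. -/
noncomputable def output₂ (S : Plant X U Y₁ Y₂ W) (μ : ℝ) (w : EuclideanSpace ℝ W)
    (z : EuclideanSpace ℝ (X ⊕ (U ⊕ Y₂))) : EuclideanSpace ℝ Y₂ :=
  toEuclideanLin S.C₂ (xPart z) + toEuclideanLin S.D₂w w + μ • lPart z

/-- The feedback nonlinearity of the closed loop. The linear part `m u` of the gradient of the
`m`-strongly convex cost is moved to the linear part of the loop. -/
noncomputable def feedback (S : Plant X U Y₁ Y₂ W) (m μ : ℝ) (f : EuclideanSpace ℝ U → ℝ)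
    (h : EuclideanSpace ℝ Y₁ → ℝ) (g : EuclideanSpace ℝ Y₂ → EReal) (w : EuclideanSpace ℝ W)
    (z : EuclideanSpace ℝ (X ⊕ (U ⊕ Y₂))) : U ⊕ (Y₁ ⊕ Y₂) → ℝ :=
  Sum.elim (gradient f (uPart z) - m • uPart z).ofLp
    (Sum.elim (gradient h (output₁ S w z)).ofLp
      (μ • gradient (moreau μ g) (output₂ S μ w z)).ofLp)

theorem ofLp_closedLoopField (S : Plant X U Y₁ Y₂ W) (Q : Matrix Y₂ Y₂ ℝ) {m μ γ ε : ℝ}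
    (hμ : μ ≠ 0) (f : ℝ → EuclideanSpace ℝ U → ℝ) (h : ℝ → EuclideanSpace ℝ Y₁ → ℝ)
    (g : ℝ → EuclideanSpace ℝ Y₂ → EReal) (w : ℝ → EuclideanSpace ℝ W)
    (t : ℝ) (z : EuclideanSpace ℝ (X ⊕ (U ⊕ Y₂))) :
    (closedLoopField S Q μ γ ε f h g w t z).ofLp =
      S.matA Q m μ γ ε *ᵥ z.ofLp + S.matB μ *ᵥ feedback S m μ (f t) (h t) (g t) (w t) z
        + Sum.elim (ε⁻¹ • (S.Bw *ᵥ (w t).ofLp)) 0 := by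
  have hl : (closedLoopField S Q μ γ ε f h g w t z).ofLp =
      Sum.elim (ε⁻¹ • (S.A *ᵥ (xPart z).ofLp + S.B *ᵥ (uPart z).ofLp + S.Bw *ᵥ (w t).ofLp))
        (Sum.elim (-(gradient (f t) (uPart z)).ofLp
            - S.Pi₁uᵀ *ᵥ (gradient (h t) (output₁ S (w t) z)).ofLp
            - S.Pi₂uᵀ *ᵥ (gradient (moreau μ (g t)) (output₂ S μ (w t) z)).ofLp)
          (μ • ((gradient (moreau μ (g t)) (output₂ S μ (w t) z)).ofLp - (lPart z).ofLp)
            - γ • (Q *ᵥ (lPart z).ofLp))) := rfl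
  rw [hl, ofLp_eq_sumElim_parts z, feedback, Plant.matA, Plant.matB, blocks3_mulVec,
    blocks3_mulVec, ← Sum.elim_zero_zero, ← Sum.elim_add_add, ← Sum.elim_add_add,
    ← Sum.elim_add_add, ← Sum.elim_add_add]
  congr 1
  · simp [smul_mulVec, smul_add]
  congr 1
  · simp only [smul_mulVec, one_mulVec, neg_mulVec, zero_mulVec, zero_add, add_zero,
      WithLp.ofLp_sub, WithLp.ofLp_smul, mulVec_smul]
    match_scalars <;> simp [hμ]
  · simp only [smul_mulVec, one_mulVec, sub_mulVec, zero_mulVec, zero_add, add_zero,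
      WithLp.ofLp_smul]
    module

/-- The speed-up of the plant does not move the stationary points. -/
theorem closedLoopField_eq_zero_of_eq_one (S : Plant X U Y₁ Y₂ W) (Q : Matrix Y₂ Y₂ ℝ)
    {μ γ : ℝ} (ε : ℝ) {f : ℝ → EuclideanSpace ℝ U → ℝ} {h : ℝ → EuclideanSpace ℝ Y₁ → ℝ}
    {g : ℝ → EuclideanSpace ℝ Y₂ → EReal} {w : ℝ → EuclideanSpace ℝ W}
    {t : ℝ} {z : EuclideanSpace ℝ (X ⊕ (U ⊕ Y₂))}
    (hz : closedLoopField S Q μ γ 1 f h g w t z = 0) :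
    closedLoopField S Q μ γ ε f h g w t z = 0 := by
  have hx : ∀ i, (toEuclideanLin S.A (xPart z) + toEuclideanLin S.B (uPart z) +
      toEuclideanLin S.Bw (w t)) i = 0 := fun i => by
    have := congrArg (fun y : EuclideanSpace ℝ (X ⊕ (U ⊕ Y₂)) => y (Sum.inl i)) hz
    simpa [closedLoopField, stack] using this
  ext (i | i)
  · have : (closedLoopField S Q μ γ ε f h g w t z) (Sum.inl i) = ε⁻¹ * (toEuclideanLin S.A (xPart z)
      + toEuclideanLin S.B (uPart z) + toEuclideanLin S.Bw (w t)) i := rfl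
    rw [this, hx]
    simp
  · have : (closedLoopField S Q μ γ ε f h g w t z) (Sum.inr i)
        = (closedLoopField S Q μ γ 1 f h g w t z) (Sum.inr i) := rfl
    rw [this, hz]

theorem ofLp_dotProduct_ofLp {n : Type*} [Fintype n] (x y : EuclideanSpace ℝ n) :
    x.ofLp ⬝ᵥ y.ofLp = ⟪x, y⟫ := by
  rw [EuclideanSpace.inner_eq_star_dotProduct, star_trivial, dotProduct_comm]

/-- Incremental dissipation inequality of the closed loop, from the LMI and the incremental sector
bounds of the three gradients. -/
theorem closedLoopField_dissipation (S : Plant X U Y₁ Y₂ W) {Q : Matrix Y₂ Y₂ ℝ}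
    {m Lf Lh μ γ ε ρ φ₁ φ₂ : ℝ} (hLf : m ≤ Lf) (hLh : 0 ≤ Lh) (hμ : 0 < μ)
    (hφ₁ : 0 ≤ φ₁) (hφ₂ : 0 ≤ φ₂) {P : Matrix (X ⊕ (U ⊕ Y₂)) (X ⊕ (U ⊕ Y₂)) ℝ} (hP : P.PosDef)
    (hLMI : SatisfiesLMI (S.matA Q m μ γ ε + ρ • 1) (S.matB μ) (S.matC μ) P
      (multiplier U Y₁ Y₂ (Lf - m) Lh φ₁ φ₂))
    {f : ℝ → EuclideanSpace ℝ U → ℝ} {h : ℝ → EuclideanSpace ℝ Y₁ → ℝ}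
    {g : ℝ → EuclideanSpace ℝ Y₂ → EReal} (w : ℝ → EuclideanSpace ℝ W)
    (hc : CostAssumption m Lf Lh f h g) {t : ℝ} (ht : 0 ≤ t)
    (z z' : EuclideanSpace ℝ (X ⊕ (U ⊕ Y₂))) :
    (P *ᵥ (z - z').ofLp) ⬝ᵥ (closedLoopField S Q μ γ ε f h g w t z -
        closedLoopField S Q μ γ ε f h g w t z').ofLp ≤
      -ρ * ((P *ᵥ (z - z').ofLp) ⬝ᵥ (z - z').ofLp) := by
  have hPt : Pᵀ = P := by
    simpa [conjTranspose_eq_transpose_of_trivial] using hP.isHermitian.eq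
  rw [satisfiesLMI_iff hPt (multiplier_transpose _ _ _ _ _ _ _)] at hLMI
  set p := (gradient (f t) (uPart z) - gradient (f t) (uPart z')) - m • (uPart z - uPart z')
    with hp
  set y₁ := output₁ S (w t) z with hy₁
  set y₁' := output₁ S (w t) z' with hy₁'
  set y₂ := output₂ S μ (w t) z with hy₂
  set y₂' := output₂ S μ (w t) z' with hy₂'
  set q := gradient (h t) y₁ - gradient (h t) y₁' with hq
  set r := μ • (gradient (moreau μ (g t)) y₂ - gradient (moreau μ (g t)) y₂') with hr
  have hfb : feedback S m μ (f t) (h t) (g t) (w t) z - feedback S m μ (f t) (h t) (g t) (w t) z'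
      = Sum.elim p.ofLp (Sum.elim q.ofLp r.ofLp) := by
    rw [feedback, feedback, ← Sum.elim_sub_sub, ← Sum.elim_sub_sub, hr, smul_sub, hp, smul_sub,
      sub_sub_sub_comm]
    rfl
  have hC : S.matC μ *ᵥ (z - z').ofLp = Sum.elim (uPart z - uPart z').ofLp
      (Sum.elim (y₁ - y₁').ofLp (y₂ - y₂').ofLp) := by
    rw [WithLp.ofLp_sub, mulVec_sub, ofLp_eq_sumElim_parts z, ofLp_eq_sumElim_parts z',
      Plant.matC, blocks3_mulVec, blocks3_mulVec, ← Sum.elim_sub_sub, ← Sum.elim_sub_sub]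
    congr 1
    · simp
    congr 1
    · simp [hy₁, hy₁', output₁]
    · simp [hy₂, hy₂', output₂, smul_mulVec]
      abel
  have hF : (closedLoopField S Q μ γ ε f h g w t z -
      closedLoopField S Q μ γ ε f h g w t z').ofLp = S.matA Q m μ γ ε *ᵥ (z - z').ofLp +
        S.matB μ *ᵥ Sum.elim p.ofLp (Sum.elim q.ofLp r.ofLp) := by
    rw [← hfb, WithLp.ofLp_sub, ofLp_closedLoopField S Q (m := m) hμ.ne',
      ofLp_closedLoopField S Q (m := m) hμ.ne', WithLp.ofLp_sub, mulVec_sub, mulVec_sub]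
    abel
  have hd := hLMI (z - z').ofLp (Sum.elim p.ofLp (Sum.elim q.ofLp r.ofLp))
  rw [hC, dotProduct_multiplier_mulVec, add_mulVec, add_right_comm, ← hF, smul_mulVec,
    one_mulVec, dotProduct_add, dotProduct_smul, smul_eq_mul] at hd
  have s₁ : 0 ≤ (Lf - m) * ((uPart z - uPart z').ofLp ⬝ᵥ p.ofLp) - p.ofLp ⬝ᵥ p.ofLp := by
    have := norm_sub_sq_le_of_strongConvexOn hLf (hc.f_strong t ht) (hc.f_grad t ht)
      (uPart z) (uPart z')
    rw [ofLp_dotProduct_ofLp, ofLp_dotProduct_ofLp, real_inner_self_eq_norm_sq, real_inner_comm]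
    linarith
  have s₂ : 0 ≤ Lh * ((y₁ - y₁').ofLp ⬝ᵥ q.ofLp) - q.ofLp ⬝ᵥ q.ofLp := by
    have := norm_sub_sq_le_of_strongConvexOn hLh (strongConvexOn_zero.mpr (hc.h_convex t ht))
      (hc.h_grad t ht) y₁ y₁'
    rw [zero_smul, sub_zero, sub_zero] at this
    rw [ofLp_dotProduct_ofLp, ofLp_dotProduct_ofLp, real_inner_self_eq_norm_sq, real_inner_comm]
    linarith
  have s₃ : 0 ≤ (y₂ - y₂').ofLp ⬝ᵥ r.ofLp - r.ofLp ⬝ᵥ r.ofLp := by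
    have := (hc.g_proper t ht).norm_sub_sq_le_inner_gradient_moreau hμ y₂ y₂'
    rw [ofLp_dotProduct_ofLp, ofLp_dotProduct_ofLp, real_inner_self_eq_norm_sq, real_inner_comm]
    linarith
  have t₁ := mul_nonneg hφ₁ s₁
  have t₂ := mul_nonneg hφ₂ s₂
  linarith

end Tracking

end OnlineOpt

theorem theorem3 {X U Y₁ Y₂ W : Type*}
    [Fintype X] [DecidableEq X] [Fintype U] [DecidableEq U] [Fintype Y₁] [DecidableEq Y₁]
    [Fintype Y₂] [DecidableEq Y₂] [Fintype W] [DecidableEq W]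
    (S : OnlineOpt.Plant X U Y₁ Y₂ W) (hA : OnlineOpt.IsHurwitz S.A)
    (Q : Matrix Y₂ Y₂ ℝ) (hQ : Q.PosSemidef)
    (hnull : LinearMap.ker (S.Pi₂u * S.Pi₂uᵀ).mulVecLin ⊓ LinearMap.ker Q.mulVecLin = ⊥)
    (m Lf Lh μ : ℝ) (hm : 0 < m) (hLf : m ≤ Lf) (hLh : 0 ≤ Lh)
    (hμ : 0 < μ) (hμL : max (Lf - m) Lh ≤ μ)
    (γ : ℝ) (hγ : 0 < γ) :
    ∃ ε ρ φ₁ φ₂ : ℝ, 0 < ε ∧ 0 < ρ ∧ 0 ≤ φ₁ ∧ 0 ≤ φ₂ ∧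
    ∃ P : Matrix (X ⊕ (U ⊕ Y₂)) (X ⊕ (U ⊕ Y₂)) ℝ, P.PosDef ∧
      OnlineOpt.SatisfiesLMI (S.matA Q m μ γ ε + ρ • 1) (S.matB μ) (S.matC μ) P
        (OnlineOpt.multiplier U Y₁ Y₂ (Lf - m) Lh φ₁ φ₂) ∧
      -- tracking of the approximate optimal trajectory
      ∀ (f : ℝ → EuclideanSpace ℝ U → ℝ) (h : ℝ → EuclideanSpace ℝ Y₁ → ℝ)
        (g : ℝ → EuclideanSpace ℝ Y₂ → EReal) (w : ℝ → EuclideanSpace ℝ W),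
        OnlineOpt.CostAssumption m Lf Lh f h g →
        ∀ z zs zs' : ℝ → EuclideanSpace ℝ (X ⊕ (U ⊕ Y₂)),
          OnlineOpt.IsCaratheodorySolution (OnlineOpt.closedLoopField S Q μ γ ε f h g w) z →
          OnlineOpt.IsStationaryTrajectory (OnlineOpt.closedLoopField S Q μ γ 1 f h g w) zs →
          OnlineOpt.IsIntegralOf zs zs' →
          ∀ t, 0 ≤ t →
            ‖z t - zs t‖ ≤
              √(OnlineOpt.condNumber P) * ‖z 0 - zs 0‖ * Real.exp (-ρ * t) +
              √(OnlineOpt.condNumber P) *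
                ∫ τ in (0 : ℝ)..t, Real.exp (-ρ * (t - τ)) * ‖zs' τ‖ := by
  obtain ⟨ε, ρ, φ₁, φ₂, hε, hρ, hφ₁, hφ₂, P, hP, hLMI⟩ :=
    OnlineOpt.exists_satisfiesLMI S hA hQ hnull hm (sub_nonneg.mpr hLf) hLh hμ hγ
  refine ⟨ε, ρ, φ₁, φ₂, hε, hρ, hφ₁, hφ₂, P, hP, hLMI, ?_⟩
  intro f h g w hc z zs zs' hz hstat hzs
  refine OnlineOpt.norm_sub_le_of_dissipation hP hz hzs fun τ hτ => ?_
  have hd := OnlineOpt.closedLoopField_dissipation S hLf hLh hμ hφ₁ hφ₂ hP hLMI w hc hτ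
    (z τ) (zs τ)
  rwa [OnlineOpt.closedLoopField_eq_zero_of_eq_one S Q ε (hstat τ hτ), sub_zero] at hd
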